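/- Let $d\in\mathbb N$, let $\mathcal P_2(\mathbb R^d\times\mathbb R^d)$ be the Borel probability measures on $\mathbb R^d\times\mathbb R^d$ with finite second moment $M_2$, with the Wasserstein distances $\mathbf d_1,\mathbf d_2$, and let $D_\mu$ and $\frac{\delta}{\delta m}$ denote the Wasserstein (intrinsic) and the linear functional derivative. Let $L:\mathbb R^d\times\mathbb R^d\times\mathcal P_2(\mathbb R^d\times\mathbb R^d)\to\mathbb R$, $L=L(x,a,\mu)$, and $$H(x,p,\mu)=\sup_{a\in\mathbb R^d}\{-a\cdot p-L(x,a,\mu)\}.$$ For functions of vectors and of a measure, "of class $C^k$" means that all mixed derivatives up to order $k$ in the vector variables, in the measure variable, and in the auxiliary variables created by the measure derivatives exist and are jointly continuous (with respect to $\mathbf d_2$ in the measure). Assume the following. 1. (Regularity) $L$ and $H$ are of class $C^5$ with uniformly bounded derivatives of orders $2,3,4,5$; $D_\mu L$ is bounded; there is $c>0$ with $D_{aa}L\ge c\,I_{d\times d}$ everywhere; there is $C_0>0$ with $\frac1{C_0}|a|^2-C_0\le L(x,a,\mu)\le C_0\big(1+|x|^2+|a|^2+M_2^{1/2}(\mu)\big)$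 for all $(x,a,\mu)$; and the maps $(x,a,\mu,x',a')\mapsto\frac{\delta}{\delta m}D_xL(x,a,\mu,x',a')$ and $(x,a,\mu,x',a')\mapsto\frac{\delta}{\delta m}D_aL(x,a,\mu,x',a')$ are uniformly Lipschitz continuous, with respect to $\mathbf d_1$ in $\mu$. 2. (Monotonicity) There are constants $C_{L,a}>0$, $C_{L,x}\ge0$ such that for all square-integrable $\mathbb R^d$-valued random vectors $X,X',\alpha,\alpha'$ on a common probability space, with $\mathcal L$ denoting the law, $$\mathbb E\Big[\big(D_aL(X,\alpha,\mathcal L(X,\alpha))-D_aL(X',\alpha',\mathcal L(X',\alpha'))\big)\cdot(\alpha-\alpha')+\big(D_xL(X,\alpha,\mathcal L(X,\alpha))-D_xL(X',\alpha',\mathcal L(X',\alpha'))\big)\cdot(X-X')\Big]\ge C_{L,a}\mathbb E|\alpha-\alpha'|^2-C_{L,x}\mathbb E|X-X'|^2 .$$ For $N\ge2$ and $\boldsymbol x,\boldsymbol a\in(\mathbb R^d)^N$ write $m^{N,-i}_{\boldsymbol x,\boldsymbol a}=\frac1{N-1}\sum_{j\ne i}\delta_{(x^j,a^j)}$, and for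 indices $i_1,\dots,i_r\in\{1,\dots,N\}$ put $\omega^N_{i_1,\dots,i_r}=N^{1-\mathrm{dist}(i_1,\dots,i_r)}$, where $\mathrm{dist}$ is the number of distinct integers among $i_1,\dots,i_r$. Then there are a constant $C$ and an integer $N_0$ such that for every $N\ge \max(N_0,2)$ the following holds. For all $\boldsymbol x,\boldsymbol p\in(\mathbb R^d)^N$ the system $$a^i=-D_pH\big(x^i,p^i,m^{N,-i}_{\boldsymbol x,\boldsymbol a}\big),\qquad i=1,\dots,N,$$ has exactly one solution $\boldsymbol a=\boldsymbol a^N(\boldsymbol x,\boldsymbol p)\in(\mathbb R^d)^N$; the map $\boldsymbol a^N=(a^{N,1},\dots,a^{N,N}):(\mathbb R^d)^N\times(\mathbb R^d)^N\to(\mathbb R^d)^N$ is of class $C^4$; and for all $i,j,k,l\in\{1,\dots,N\}$, $$\|D_{x^j}a^{N,i}\|_\infty+\|D_{p^j}a^{N,i}\|_\infty\le C\,\omega^N_{i,j},$$ $$\|D_{x^kx^j}a^{N,i}\|_\infty+\|D_{x^kp^j}a^{N,i}\|_\infty+\|D_{p^kp^j}a^{N,i}\|_\infty\le C\,\omega^N_{i,j,k},$$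 $$\|D_{x^lx^kx^j}a^{N,i}\|_\infty+\|D_{x^lx^kp^j}a^{N,i}\|_\infty+\|D_{x^lp^kp^j}a^{N,i}\|_\infty+\|D_{p^lp^kp^j}a^{N,i}\|_\infty\le C\,\omega^N_{i,j,k,l}.$$ -/

import Mathlib

open MeasureTheory
open scoped ENNReal NNReal InnerProductSpace

noncomputable section

/-! ### Probability measures with finite second moment and Wasserstein distances -/

section Wasserstein

variable {F : Type} [NormedAddCommGroup F] [MeasurableSpace F]

/-- Borel probability measures on `F` with finite second moment. -/
def P2 (F : Type) [NormedAddCommGroup F] [MeasurableSpace F] : Type :=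
  {μ : Measure F // IsProbabilityMeasure μ ∧ ∫⁻ y, ‖y‖ₑ ^ 2 ∂μ < ∞}

/-- `π` is a coupling of `μ` and `ν`. -/
def IsCoupling (π : Measure (F × F)) (μ ν : P2 F) : Prop :=
  π.map Prod.fst = μ.1 ∧ π.map Prod.snd = ν.1

/-- The `p`-Wasserstein distance `inf_π ‖y - y'‖_{L^p(π)}`, over all couplings `π`. -/
def wassersteinDist (p : ℝ≥0∞) (μ ν : P2 F) : ℝ≥0∞ :=
  ⨅ (π : Measure (F × F)) (_ : IsCoupling π μ ν), eLpNorm (fun y => y.1 - y.2) p π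

/-- The mixture `t ν + (1 - t) μ`. -/
def P2.mix (t : unitInterval) (μ ν : P2 F) : P2 F :=
  ⟨ENNReal.ofReal t • ν.1 + ENNReal.ofReal (1 - t) • μ.1, by
    have := μ.2.1
    have := ν.2.1
    refine ⟨⟨?_⟩, ?_⟩
    · rw [Measure.add_apply, Measure.smul_apply, Measure.smul_apply, measure_univ, measure_univ,
        smul_eq_mul, smul_eq_mul, mul_one, mul_one,
        ← ENNReal.ofReal_add t.2.1 (sub_nonneg.2 t.2.2)]
      simp
    · rw [lintegral_add_measure, lintegral_smul_measure, lintegral_smul_measure]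
      exact ENNReal.add_lt_top.2 ⟨ENNReal.mul_lt_top ENNReal.ofReal_lt_top ν.2.2,
        ENNReal.mul_lt_top ENNReal.ofReal_lt_top μ.2.2⟩⟩

end Wasserstein

/-! ### Calculus for functions of a vector and of a measure -/

section Calculus

variable {F : Type} [NormedAddCommGroup F] [NormedSpace ℝ F] [MeasurableSpace F]

/-- Joint continuity of `Ψ : E × P2 F → V`, where `P2 F` carries the 2-Wasserstein distance. -/
def JointlyContinuous {E V : Type} [NormedAddCommGroup E] [NormedAddCommGroup V]
    (Ψ : E → P2 F → V) : Prop :=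
  ∀ (z : E) (μ : P2 F) (ε : ℝ), 0 < ε → ∃ δ : ℝ, 0 < δ ∧ ∀ (z' : E) (μ' : P2 F),
    ‖z' - z‖ < δ → wassersteinDist 2 μ μ' < ENNReal.ofReal δ → ‖Ψ z' μ' - Ψ z μ‖ < ε

/-- `g = D_μ Ψ(μ, ·)` is the Wasserstein (intrinsic) derivative of `Ψ` at `μ`: it lies in
`L²(μ)`, and `Ψ(ν) = Ψ(μ) + ∫ g(y)(y' - y) dπ(y, y') + o(‖y' - y‖_{L²(π)})` for all couplings
`π` of `μ` and `ν`. In terms of random variables `Y ∼ μ`, `Y' ∼ ν`, this is the Fréchet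
differentiability in `L²` at `Y` of the lift `Y' ↦ Ψ(Law(Y'))`, with derivative `g(Y)`. -/
def HasWassersteinDerivAt {V : Type} [NormedAddCommGroup V] [NormedSpace ℝ V]
    (Ψ : P2 F → V) (g : F → F →L[ℝ] V) (μ : P2 F) : Prop :=
  MemLp g 2 μ.1 ∧
  ∀ ε : ℝ≥0, 0 < ε → ∃ δ : ℝ≥0, 0 < δ ∧ ∀ (ν : P2 F) (π : Measure (F × F)), IsCoupling π μ ν →
    eLpNorm (fun y => y.2 - y.1) 2 π ≤ δ →
    ‖Ψ ν - Ψ μ - ∫ y, g y.1 (y.2 - y.1) ∂π‖ₑ ≤ ε * eLpNorm (fun y => y.2 - y.1) 2 π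

/-- `Ψ : E × P2 F → V` is of class `C^k`, and all its derivatives of order `i` with
`j ≤ i ≤ k` are uniformly bounded. The first-order derivatives of `Ψ` are `D_z Ψ (z, μ)` and
`D_μ Ψ (z, μ, y)`; the latter is regarded as a function of the vector `(z, y)` and of `μ`,
so that the derivatives of order `k` are all mixed derivatives in `z`, in `μ` and in the
auxiliary variables `y` created by the previous measure derivatives. All derivatives
of order at most `k` are required to be jointly continuous. -/
def IsCkBounded : (k j : ℕ) → {E V : Type} →
    [NormedAddCommGroup E] → [NormedSpace ℝ E] → [NormedAddCommGroup V] → [NormedSpace ℝ V] →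
    (E → P2 F → V) → Prop
  | 0, j, _, _, _, _, _, _, Ψ =>
      JointlyContinuous Ψ ∧ (j = 0 → ∃ C : ℝ, ∀ z μ, ‖Ψ z μ‖ ≤ C)
  | k + 1, j, E, V, _, _, _, _, Ψ =>
      JointlyContinuous Ψ ∧ (j = 0 → ∃ C : ℝ, ∀ z μ, ‖Ψ z μ‖ ≤ C) ∧
      ∃ (DzΨ : E → P2 F → E →L[ℝ] V) (DμΨ : E × F → P2 F → F →L[ℝ] V),
        (∀ z μ, HasFDerivAt (fun z' => Ψ z' μ) (DzΨ z μ) z) ∧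
        (∀ z μ, HasWassersteinDerivAt (Ψ z) (fun y => DμΨ (z, y) μ) μ) ∧
        IsCkBounded k (j - 1) DzΨ ∧ IsCkBounded k (j - 1) DμΨ

/-- The Wasserstein derivative `D_μ Ψ (z, μ, y)` exists, is jointly continuous, and is
uniformly bounded. -/
def HasBoundedWassersteinDeriv {E V : Type} [NormedAddCommGroup E]
    [NormedAddCommGroup V] [NormedSpace ℝ V] (Ψ : E → P2 F → V) : Prop :=
  ∃ DμΨ : E × F → P2 F → F →L[ℝ] V, JointlyContinuous DμΨ ∧
    (∀ z μ, HasWassersteinDerivAt (Ψ z) (fun y => DμΨ (z, y) μ) μ) ∧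
    ∃ C : ℝ, ∀ w μ, ‖DμΨ w μ‖ ≤ C

/-- `Ψ : E × P2 F → V` has a linear functional derivative `g = δΨ/δm (z, μ, y)`, that is
`Ψ(z, ν) - Ψ(z, μ) = ∫₀¹ ∫ g(z, t ν + (1 - t) μ, y) (ν - μ)(dy) dt`, which is Lipschitz in
`(z, μ, y)`, with respect to the 1-Wasserstein distance in `μ`. (The linear functional
derivative is unique up to a function of `(z, μ)`; if one version is Lipschitz then so is the
one normalized by `∫ g(z, μ, y) μ(dy) = 0`.) -/
def HasLipschitzLinearDeriv {E V : Type} [NormedAddCommGroup E]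
    [NormedAddCommGroup V] [NormedSpace ℝ V] (Ψ : E → P2 F → V) : Prop :=
  ∃ g : E → P2 F → F → V,
    (∀ (z : E) (μ ν : P2 F), Ψ z ν - Ψ z μ =
      ∫ t : unitInterval,
        ((∫ y, g z (P2.mix t μ ν) y ∂ν.1) - ∫ y, g z (P2.mix t μ ν) y ∂μ.1)) ∧
    ∃ C : ℝ≥0, ∀ (z z' : E) (μ μ' : P2 F) (y y' : F),
      ‖g z μ y - g z' μ' y'‖ₑ ≤ C * (‖z - z'‖ₑ + wassersteinDist 1 μ μ' + ‖y - y'‖ₑ)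

end Calculus

/-! ### The data of the game and the assumptions -/

section Game

/-- The state space (and the space of controls) `ℝ^d`. -/
abbrev Rd (d : ℕ) : Type := EuclideanSpace ℝ (Fin d)

/-- Probability measures on `ℝ^d × ℝ^d` with finite second moment. The product carries the
norm `max |x| |a|`, which is equivalent to the Euclidean one, so that the square integrable
measures, the topology, and all boundedness and Lipschitz properties are the usual ones. -/
abbrev P2xa (d : ℕ) : Type := P2 (Rd d × Rd d)

variable {d : ℕ}

/-- The second moment `M₂(μ) = ∫ |x|² + |a|² dμ(x, a)`. -/
def secondMoment (μ : P2xa d) : ℝ := ∫ y, (‖y.1‖ ^ 2 + ‖y.2‖ ^ 2) ∂μ.1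

/-- The Hamiltonian `H(x, p, μ) = sup_a {- a · p - L(x, a, μ)}`. -/
def hamiltonian (L : Rd d → Rd d → P2xa d → ℝ) (x p : Rd d) (μ : P2xa d) : ℝ :=
  ⨆ a : Rd d, (-⟪a, p⟫_ℝ - L x a μ)

/-- `D_x L (x, a, μ)`. -/
def gradX (L : Rd d → Rd d → P2xa d → ℝ) (x a : Rd d) (μ : P2xa d) : Rd d :=
  gradient (fun x' => L x' a μ) x

/-- `D_a L (x, a, μ)`; applied to the Hamiltonian, this is `D_p H (x, p, μ)`. -/
def gradA (L : Rd d → Rd d → P2xa d → ℝ) (x a : Rd d) (μ : P2xa d) : Rd d :=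
  gradient (fun a' => L x a' μ) a

/-- The regularity assumption on the Lagrangian `L` and its Hamiltonian `H`. -/
structure RegularityAssumption (L : Rd d → Rd d → P2xa d → ℝ) : Prop where
  /-- `L` is of class `C^5`, with bounded derivatives of order 2, 3, 4, 5. -/
  smooth_L : IsCkBounded 5 2 (fun (z : Rd d × Rd d) μ => L z.1 z.2 μ)
  /-- `H` is of class `C^5`, with bounded derivatives of order 2, 3, 4, 5. -/
  smooth_H : IsCkBounded 5 2 (fun (z : Rd d × Rd d) μ => hamiltonian L z.1 z.2 μ)
  /-- `D_μ L` is bounded. -/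
  bounded_DμL : HasBoundedWassersteinDeriv (fun (z : Rd d × Rd d) μ => L z.1 z.2 μ)
  /-- `D_aa L ≥ c I`. -/
  strictly_convex : ∃ c : ℝ, 0 < c ∧ ∀ (x a : Rd d) (μ : P2xa d) (ξ : Rd d),
    c * ‖ξ‖ ^ 2 ≤ ⟪ξ, fderiv ℝ (fun a' => gradA L x a' μ) a ξ⟫_ℝ
  /-- Coercivity and growth. -/
  coercive : ∃ C : ℝ, 0 < C ∧ ∀ (x a : Rd d) (μ : P2xa d),
    1 / C * ‖a‖ ^ 2 - C ≤ L x a μ ∧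
    L x a μ ≤ C * (1 + ‖x‖ ^ 2 + ‖a‖ ^ 2 + Real.sqrt (secondMoment μ))
  /-- `δ/δm D_x L` is Lipschitz. -/
  lipschitz_DxL : HasLipschitzLinearDeriv (fun (z : Rd d × Rd d) μ => gradX L z.1 z.2 μ)
  /-- `δ/δm D_a L` is Lipschitz. -/
  lipschitz_DaL : HasLipschitzLinearDeriv (fun (z : Rd d × Rd d) μ => gradA L z.1 z.2 μ)

/-- The joint law of two square-integrable random vectors. -/
def jointLaw {Ω : Type} [MeasurableSpace Ω] (P : Measure Ω) [IsProbabilityMeasure P]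
    {X α : Ω → Rd d} (hX : MemLp X 2 P) (hα : MemLp α 2 P) : P2xa d :=
  ⟨P.map (fun ω => (X ω, α ω)), by
    have hm : AEMeasurable (fun ω => (X ω, α ω)) P :=
      hX.aestronglyMeasurable.aemeasurable.prodMk hα.aestronglyMeasurable.aemeasurable
    refine ⟨Measure.isProbabilityMeasure_map hm, ?_⟩
    have h : ∀ Y : Ω → Rd d, MemLp Y 2 P → ∫⁻ ω, ‖Y ω‖ₑ ^ 2 ∂P < ∞ := fun Y hY => by
      have := lintegral_rpow_enorm_lt_top_of_eLpNorm_lt_top two_ne_zero ENNReal.ofNat_ne_top hY.2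
      simpa using this
    rw [lintegral_map' (by fun_prop) hm]
    refine lt_of_le_of_lt (lintegral_mono (g := fun ω => ‖X ω‖ₑ ^ 2 + ‖α ω‖ₑ ^ 2) fun ω => ?_) ?_
    · have hh : ‖(X ω, α ω)‖ₑ = ‖X ω‖ₑ ∨ ‖(X ω, α ω)‖ₑ = ‖α ω‖ₑ := by
        rcases max_choice ‖X ω‖₊ ‖α ω‖₊ with hh | hh
        · exact Or.inl (congrArg _ hh)
        · exact Or.inr (congrArg _ hh)
      rcases hh with hh | hh <;> simp [hh]
    · rw [lintegral_add_left' (hX.aestronglyMeasurable.enorm.pow_const 2)]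
      exact ENNReal.add_lt_top.2 ⟨h X hX, h α hα⟩⟩

/-- The (semi-)monotonicity assumption on the Lagrangian. -/
def MonotonicityAssumption (L : Rd d → Rd d → P2xa d → ℝ) : Prop :=
  ∃ Ca Cx : ℝ, 0 < Ca ∧ 0 ≤ Cx ∧
    ∀ (Ω : Type) [MeasurableSpace Ω] (P : Measure Ω) [IsProbabilityMeasure P]
      (X X' α α' : Ω → Rd d) (hX : MemLp X 2 P) (hX' : MemLp X' 2 P)
      (hα : MemLp α 2 P) (hα' : MemLp α' 2 P),
      Ca * (∫ ω, ‖α ω - α' ω‖ ^ 2 ∂P) - Cx * (∫ ω, ‖X ω - X' ω‖ ^ 2 ∂P) ≤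
        ∫ ω, (⟪gradA L (X ω) (α ω) (jointLaw P hX hα) -
                gradA L (X' ω) (α' ω) (jointLaw P hX' hα'), α ω - α' ω⟫_ℝ +
              ⟪gradX L (X ω) (α ω) (jointLaw P hX hα) -
                gradX L (X' ω) (α' ω) (jointLaw P hX' hα'), X ω - X' ω⟫_ℝ) ∂P

end Game

/-! ### The discrete fixed-point map and its partial derivatives -/

section Discrete

variable {d N : ℕ}

/-- The empirical measure `m^{N,-i}_{x,a} = 1/(N-1) ∑_{j ≠ i} δ_{(x^j, a^j)}`. -/
def empiricalOthers (hN : 2 ≤ N) (x a : Fin N → Rd d) (i : Fin N) : P2xa d :=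
  ⟨((N - 1 : ℕ) : ℝ≥0∞)⁻¹ • ∑ j ∈ Finset.univ.erase i, Measure.dirac (x j, a j), by
    have h0 : ((N - 1 : ℕ) : ℝ≥0∞) ≠ 0 := by
      rw [Nat.cast_ne_zero]; omega
    refine ⟨⟨?_⟩, ?_⟩
    · simp only [Measure.smul_apply, Measure.finsetSum_apply, measure_univ, smul_eq_mul,
        Finset.sum_const, Finset.card_erase_of_mem (Finset.mem_univ i), Finset.card_univ,
        Fintype.card_fin, nsmul_eq_mul, mul_one]
      exact ENNReal.inv_mul_cancel h0 (ENNReal.natCast_ne_top _)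
    · rw [lintegral_smul_measure, lintegral_finsetSum_measure]
      refine ENNReal.mul_lt_top (ENNReal.inv_lt_top.2 (pos_iff_ne_zero.2 h0)) ?_
      refine ENNReal.sum_lt_top.2 fun j _ => ?_
      rw [lintegral_dirac]
      exact ENNReal.pow_lt_top enorm_lt_top⟩

/-- `a` solves the fixed-point equation `a^i = - D_p H(x^i, p^i, m^{N,-i}_{x,a})`,
`i = 1, …, N`. -/
def IsFixedPoint (L : Rd d → Rd d → P2xa d → ℝ) (hN : 2 ≤ N) (x p a : Fin N → Rd d) : Prop :=
  ∀ i, a i = -gradA (hamiltonian L) (x i) (p i) (empiricalOthers hN x a i)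

variable {V : Type} [NormedAddCommGroup V] [NormedSpace ℝ V]

/-- The partial derivative `D_{x^j} f` of a function `f(x, p)` on `(ℝ^d)^N × (ℝ^d)^N`. -/
def Dx (j : Fin N) (f : (Fin N → Rd d) × (Fin N → Rd d) → V)
    (xp : (Fin N → Rd d) × (Fin N → Rd d)) : Rd d →L[ℝ] V :=
  fderiv ℝ (fun y => f (Function.update xp.1 j y, xp.2)) (xp.1 j)

/-- The partial derivative `D_{p^j} f` of a function `f(x, p)` on `(ℝ^d)^N × (ℝ^d)^N`. -/
def Dp (j : Fin N) (f : (Fin N → Rd d) × (Fin N → Rd d) → V)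
    (xp : (Fin N → Rd d) × (Fin N → Rd d)) : Rd d →L[ℝ] V :=
  fderiv ℝ (fun q => f (xp.1, Function.update xp.2 j q)) (xp.2 j)

/-- The supremum norm `‖f‖_∞` (with the operator norm on derivatives), possibly infinite. -/
def supNorm (f : (Fin N → Rd d) × (Fin N → Rd d) → V) : ℝ≥0∞ := ⨆ xp, ‖f xp‖ₑ

/-- `ω = N^{1 - dist}`, where `dist` is the number of distinct indices in the tuple, that is
the cardinality of the set `s` of its entries. -/
def omegaN (s : Finset (Fin N)) : ℝ := (N : ℝ) ^ (1 - (s.card : ℤ))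

end Discrete

end

/-!
Legendre duality turns the fixed-point equation `a^i = -D_p H(x^i, p^i, m^{-i})` into
`D_a L(x^i, a^i, m^{-i}) = -p^i` (`RegularityAssumption.eq_neg_gradA_hamiltonian_iff`): the
supremum defining `H` is attained by coercivity, the tangent plane of `H` at `p` is given by any
maximizer, and `D_a L` is injective in `a` by uniform convexity.

*Solvability.* If `m^{-i}` is replaced by the empirical measure of all players, the monotonicity
assumption, applied on the probability space `{1, …, N}` with `X = X'`, says that the map
`a ↦ (D_a L(x^i, a^i, m))_i` is strongly monotone. Going back to `m^{-i}` changes the weights of the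
atoms, and since the linear functional derivative of `D_a L` is Lipschitz, the error has a Lipschitz
constant of order `1/N`, which is absorbed for large `N` (`exists_sum_inner_othersMeasure`). A
strongly monotone `C^n` map of `(ℝ^d)^N` is a bijection, because its range is open by the inverse
function theorem and closed by the monotonicity estimate; by the inverse function theorem again,
the solution map is `C^n` (`exists_contDiff_solution`).

*Decay of the derivatives.* Let us say that a function of the blocks `(x^j, p^j)` is attached to a
set `S` of indices if its block derivatives in `j₁, …, jᵣ` are of size `ω` of `S ∪ {j₁, …, jᵣ}`,
uniformly in `N` (`OmegaClass`). This notion is stable under the operations that occur when the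
equation is differentiated, because `∑ₘ ω_{S ∪ m} ω_{T ∪ m} ≲ ω_{S ∪ T}`: products summed over a
common index (`OmegaClass.sum_bilinear`), composition (`exists_omegaClass_comp`), and the solution
of linear systems (`exists_omegaClass_solution`). The last one rests on an estimate for a single
coercive matrix with bounded diagonal blocks and off-diagonal blocks of size `1/N`
(`exists_omegaSolvable_of_coercive`). The derivative of `D_a L(x^i, a^i, m^{-i})` in the block `m`
is attached to `{i, m}`, each atom of `m^{-i}` having mass `1/(N-1)`
(`IsCkBounded.exists_omegaClass_blockDeriv`). Differentiating
`D_a L(x^i, a^i(x, p), m^{-i}) = -p^i` gives a linear system for the derivative of `a` whose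
coefficients are compositions with `a` itself, and an induction on the order of the derivatives
concludes (`exists_omegaClass_solutionMap`).

All the constants have to be independent of `N`; they are therefore produced by existential
statements which quantify over `N` (and over the spaces and functions involved) afterwards.
-/

noncomputable section

/-! ### Arithmetic of the weights `ω` -/

section Weights

variable {N : ℕ}

theorem omegaN_nonneg (S : Finset (Fin N)) : 0 ≤ omegaN S := by
  unfold omegaN; positivity

theorem one_le_natCast_of_neZero [NeZero N] : (1 : ℝ) ≤ N := by
  exact_mod_cast Nat.pos_of_ne_zero (NeZero.ne N)

theorem omegaN_singleton (i : Fin N) : omegaN {i} = 1 := by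
  simp [omegaN]

theorem omegaN_pair_of_ne {i j : Fin N} (h : i ≠ j) : omegaN {i, j} = (N : ℝ)⁻¹ := by
  simp only [omegaN, Finset.card_pair h]
  norm_num

theorem omegaN_insert_of_notMem [NeZero N] {i : Fin N} {S : Finset (Fin N)} (h : i ∉ S) :
    omegaN (insert i S) = omegaN S / N := by
  have h0 : (N : ℝ) ≠ 0 := by exact_mod_cast NeZero.ne N
  rw [omegaN, omegaN, Finset.card_insert_of_notMem h, div_eq_mul_inv, ← zpow_sub_one₀ h0]
  congr 1
  push_cast
  ring

theorem omegaN_mul_le [NeZero N] {S T : Finset (Fin N)} (h : (S ∩ T).Nonempty) :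
    omegaN S * omegaN T ≤ omegaN (S ∪ T) := by
  have h0 : (N : ℝ) ≠ 0 := by exact_mod_cast NeZero.ne N
  have hc := Finset.card_union_add_card_inter S T
  have hp := Finset.card_pos.2 h
  rw [omegaN, omegaN, omegaN, ← zpow_add₀ h0]
  exact zpow_le_zpow_right₀ one_le_natCast_of_neZero (by omega)

/-- The weights are stable under summation over a common index: the `N` indices outside
`S ∪ T` gain a factor `1/N` each, while the others are boundedly many. -/
theorem sum_omegaN_insert_mul_le [NeZero N] (S T : Finset (Fin N)) :
    ∑ m, omegaN (insert m S) * omegaN (insert m T) ≤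
      ((S.card + T.card + 1 : ℕ) : ℝ) * omegaN (S ∪ T) := by
  have hN : (0 : ℝ) < N := zero_lt_one.trans_le one_le_natCast_of_neZero
  have key : ∀ m : Fin N, omegaN (insert m S) * omegaN (insert m T) ≤
      (if m ∈ S ∪ T then omegaN (S ∪ T) else 0) + omegaN (S ∪ T) / N := by
    intro m
    have h1 : omegaN (insert m S) * omegaN (insert m T) ≤ omegaN (insert m (S ∪ T)) := by
      refine (omegaN_mul_le ⟨m, by simp⟩).trans_eq ?_
      congr 1
      ext; simp
    split_ifs with hm
    · rw [Finset.insert_eq_of_mem hm] at h1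
      have := omegaN_nonneg (S ∪ T)
      have : 0 ≤ omegaN (S ∪ T) / N := by positivity
      linarith
    · rw [zero_add, ← omegaN_insert_of_notMem hm]
      exact h1
  refine (Finset.sum_le_sum fun m _ => key m).trans ?_
  rw [Finset.sum_add_distrib, Finset.sum_const, ← Finset.sum_filter, Finset.sum_const,
    Finset.card_univ, Fintype.card_fin, nsmul_eq_mul, nsmul_eq_mul, mul_div_cancel₀ _ hN.ne',
    Finset.filter_mem_eq_inter, Finset.univ_inter]
  have hc : ((S ∪ T).card : ℝ) ≤ S.card + T.card := by exact_mod_cast Finset.card_union_le S T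
  have := omegaN_nonneg (S ∪ T)
  push_cast
  nlinarith

end Weights

/-! ### Functions whose derivatives decay with the number of distinct blocks -/

section OmegaClass

variable {N : ℕ} {W Q : Type} [NormedAddCommGroup W] [NormedSpace ℝ W]
  [NormedAddCommGroup Q] [NormedSpace ℝ Q]

/-- The partial derivative of `f` in the `j`-th block of variables, where `E j` is the inclusion
of that block. -/
def blockDeriv (E : Fin N → Q →L[ℝ] W) (j : Fin N) {V : Type} [NormedAddCommGroup V]
    [NormedSpace ℝ V] (f : W → V) (w : W) : Q →L[ℝ] V :=
  (fderiv ℝ f w).comp (E j)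

/-- `f` and its block derivatives `D_{j₁} … D_{jᵣ} f` with `r ≤ k` exist and are bounded by
`C ω_{S ∪ {j₁, …, jᵣ}}`. Such a function `f` is said to be attached to `S`. -/
def OmegaClass (E : Fin N → Q →L[ℝ] W) : (k : ℕ) → (S : Finset (Fin N)) → (C : ℝ) → {V : Type} →
    [NormedAddCommGroup V] → [NormedSpace ℝ V] → (W → V) → Prop
  | 0, S, C, _, _, _, f => ∀ w, ‖f w‖ ≤ C * omegaN S
  | k + 1, S, C, _, _, _, f => (∀ w, ‖f w‖ ≤ C * omegaN S) ∧ Differentiable ℝ f ∧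
      ∀ j, OmegaClass E k (insert j S) C (blockDeriv E j f)

variable {E : Fin N → Q →L[ℝ] W} {V V₁ V₂ V₃ : Type}
  [NormedAddCommGroup V] [NormedSpace ℝ V] [NormedAddCommGroup V₁] [NormedSpace ℝ V₁]
  [NormedAddCommGroup V₂] [NormedSpace ℝ V₂] [NormedAddCommGroup V₃] [NormedSpace ℝ V₃]

theorem OmegaClass.bound {k : ℕ} {S : Finset (Fin N)} {C : ℝ} {f : W → V}
    (h : OmegaClass E k S C f) (w : W) : ‖f w‖ ≤ C * omegaN S := by
  cases k with
  | zero => exact h w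
  | succ k => exact h.1 w

theorem OmegaClass.of_succ {k : ℕ} {S : Finset (Fin N)} {C : ℝ} {f : W → V}
    (h : OmegaClass E (k + 1) S C f) : OmegaClass E k S C f := by
  induction k generalizing S V with
  | zero => exact h.1
  | succ k ih => exact ⟨h.1, h.2.1, fun j => ih (h.2.2 j)⟩

theorem OmegaClass.mono {k : ℕ} {S : Finset (Fin N)} {C C' : ℝ} {f : W → V}
    (h : OmegaClass E k S C f) (hC : C ≤ C') : OmegaClass E k S C' f := by
  have hb : ∀ w, ‖f w‖ ≤ C' * omegaN S := fun w =>
    (h.bound w).trans (mul_le_mul_of_nonneg_right hC (omegaN_nonneg S))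
  induction k generalizing S V with
  | zero => exact hb
  | succ k ih =>
    refine ⟨hb, h.2.1, fun j => ih (h.2.2 j) fun w => ?_⟩
    exact ((h.2.2 j).bound w).trans (mul_le_mul_of_nonneg_right hC (omegaN_nonneg _))

theorem OmegaClass.of_le {k l : ℕ} {S : Finset (Fin N)} {C : ℝ} {f : W → V}
    (h : OmegaClass E l S C f) (hk : k ≤ l) : OmegaClass E k S C f := by
  induction hk with
  | refl => exact h
  | step _ ih => exact ih h.of_succ

theorem omegaClass_zero (k : ℕ) (S : Finset (Fin N)) {C : ℝ} (hC : 0 ≤ C) :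
    OmegaClass E k S C (fun _ => (0 : V)) := by
  have hb : ∀ S : Finset (Fin N), 0 ≤ C * omegaN S := fun S =>
    mul_nonneg hC (omegaN_nonneg S)
  induction k generalizing S V with
  | zero => intro w; simpa using hb S
  | succ k ih =>
    refine ⟨fun w => by simpa using hb S, differentiable_const _, fun j => ?_⟩
    have : blockDeriv E j (fun _ : W => (0 : V)) = fun _ => 0 := by
      funext w; simp [blockDeriv]
    rw [this]
    exact ih _

theorem omegaClass_const (k : ℕ) (S : Finset (Fin N)) {C : ℝ} (hC : 0 ≤ C) {v : V}
    (hv : ‖v‖ ≤ C * omegaN S) : OmegaClass E k S C (fun _ => v) := by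
  cases k with
  | zero => exact fun _ => hv
  | succ k =>
    refine ⟨fun _ => hv, differentiable_const _, fun j => ?_⟩
    have : blockDeriv E j (fun _ : W => v) = fun _ => 0 := by
      funext w; simp [blockDeriv]
    rw [this]
    exact omegaClass_zero k _ hC

theorem OmegaClass.add {k : ℕ} {S : Finset (Fin N)} {C C' : ℝ} {f g : W → V}
    (hf : OmegaClass E k S C f) (hg : OmegaClass E k S C' g) :
    OmegaClass E k S (C + C') (fun w => f w + g w) := by
  have hb : ∀ w, ‖f w + g w‖ ≤ (C + C') * omegaN S := fun w =>
    (norm_add_le _ _).trans (by rw [add_mul]; exact add_le_add (hf.bound w) (hg.bound w))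
  induction k generalizing S V with
  | zero => exact hb
  | succ k ih =>
    refine ⟨hb, hf.2.1.add hg.2.1, fun j => ?_⟩
    have : blockDeriv E j (fun w => f w + g w) =
        fun w => blockDeriv E j f w + blockDeriv E j g w := by
      funext w
      simp only [blockDeriv]
      rw [fderiv_fun_add (hf.2.1 w) (hg.2.1 w), ContinuousLinearMap.add_comp]
    rw [this]
    refine ih (hf.2.2 j) (hg.2.2 j) fun w => ?_
    exact (norm_add_le _ _).trans
      (by rw [add_mul]; exact add_le_add ((hf.2.2 j).bound w) ((hg.2.2 j).bound w))

theorem blockDeriv_clm_comp {f : W → V₁} (hf : Differentiable ℝ f) (ℓ : V₁ →L[ℝ] V₂) (j : Fin N) :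
    blockDeriv E j (fun w => ℓ (f w)) =
      fun w => ContinuousLinearMap.compL ℝ Q V₁ V₂ ℓ (blockDeriv E j f w) := by
  funext w
  simp only [blockDeriv]
  rw [fderiv_fun_comp w ℓ.differentiableAt (hf w), ContinuousLinearMap.fderiv]
  rfl

/-- Composition with a fixed linear map. -/
theorem OmegaClass.clm_comp {k : ℕ} {S : Finset (Fin N)} {C K : ℝ} {f : W → V₁}
    (hf : OmegaClass E k S C f) (ℓ : V₁ →L[ℝ] V₂) (hK : ‖ℓ‖ ≤ K) :
    OmegaClass E k S (K * C) (fun w => ℓ (f w)) := by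
  have hb : ∀ w, ‖ℓ (f w)‖ ≤ K * C * omegaN S := fun w => by
    rw [mul_assoc]
    exact ℓ.le_of_opNorm_le_of_le hK (hf.bound w)
  induction k generalizing S V₁ V₂ with
  | zero => exact hb
  | succ k ih =>
    refine ⟨hb, ℓ.differentiable.comp hf.2.1, fun j => ?_⟩
    rw [blockDeriv_clm_comp hf.2.1]
    have hK' : ‖ContinuousLinearMap.compL ℝ Q V₁ V₂ ℓ‖ ≤ K := by
      refine ContinuousLinearMap.opNorm_le_bound _ ((norm_nonneg ℓ).trans hK) fun T => ?_
      exact (ℓ.opNorm_comp_le T).trans (mul_le_mul_of_nonneg_right hK (norm_nonneg T))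
    refine ih (hf.2.2 j) _ hK' fun w => ?_
    rw [mul_assoc]
    exact (ℓ.opNorm_comp_le _).trans
      (mul_le_mul hK ((hf.2.2 j).bound w) (norm_nonneg _) ((norm_nonneg ℓ).trans hK))

theorem OmegaClass.clm_comp_right {k : ℕ} {S : Finset (Fin N)} {C K : ℝ} {f : W → V₁ →L[ℝ] V₂}
    (hf : OmegaClass E k S C f) (R : V₃ →L[ℝ] V₁) (hR : ‖R‖ ≤ K) :
    OmegaClass E k S (K * C) (fun w => (f w).comp R) := by
  refine hf.clm_comp ((ContinuousLinearMap.compL ℝ V₃ V₁ V₂).flip R) ?_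
  refine ContinuousLinearMap.opNorm_le_bound _ ((norm_nonneg R).trans hR) fun T => ?_
  rw [mul_comm]
  exact (T.opNorm_comp_le R).trans (mul_le_mul_of_nonneg_left hR (norm_nonneg T))

theorem OmegaClass.clm_comp_left {k : ℕ} {S : Finset (Fin N)} {C K : ℝ} {f : W → V₁ →L[ℝ] V₂}
    (hf : OmegaClass E k S C f) (R : V₂ →L[ℝ] V₃) (hR : ‖R‖ ≤ K) :
    OmegaClass E k S (K * C) (fun w => R.comp (f w)) := by
  refine hf.clm_comp (ContinuousLinearMap.compL ℝ V₁ V₂ V₃ R) ?_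
  refine ContinuousLinearMap.opNorm_le_bound _ ((norm_nonneg R).trans hR) fun T => ?_
  exact (R.opNorm_comp_le T).trans (mul_le_mul_of_nonneg_right hR (norm_nonneg T))

theorem OmegaClass.neg {k : ℕ} {S : Finset (Fin N)} {C : ℝ} {f : W → V}
    (hf : OmegaClass E k S C f) : OmegaClass E k S C (fun w => - f w) := by
  have h := hf.clm_comp (-ContinuousLinearMap.id ℝ V) (K := 1) (by
    rw [norm_neg]; exact ContinuousLinearMap.norm_id_le (𝕜 := ℝ) (E := V))
  simpa using h

theorem blockDeriv_bilinear (B : V₁ →L[ℝ] V₂ →L[ℝ] V₃) {f : W → V₁} {g : W → V₂}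
    (hf : Differentiable ℝ f) (hg : Differentiable ℝ g) (j : Fin N) :
    blockDeriv E j (fun w => B (f w) (g w)) = fun w =>
      B.precompR Q (f w) (blockDeriv E j g w) + B.precompL Q (blockDeriv E j f w) (g w) := by
  funext w
  simp only [blockDeriv]
  rw [B.fderiv_of_bilinear (hf w) (hg w)]
  rfl

/-- A sum over a common index `m` of products of a function attached to `S ∪ {m}` with a function
attached to `T ∪ {m}` is attached to `S ∪ T`. -/
theorem OmegaClass.sum_bilinear [NeZero N] {k n : ℕ} {S T : Finset (Fin N)} {C₁ C₂ K : ℝ}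
    (hC₁ : 0 ≤ C₁) (hC₂ : 0 ≤ C₂) (hn : S.card + T.card + k ≤ n)
    (B : V₁ →L[ℝ] V₂ →L[ℝ] V₃) (hB : ‖B‖ ≤ K) {f : Fin N → W → V₁} {g : Fin N → W → V₂}
    (hf : ∀ m, OmegaClass E k (insert m S) C₁ (f m))
    (hg : ∀ m, OmegaClass E k (insert m T) C₂ (g m)) :
    OmegaClass E k (S ∪ T) (2 ^ k * (K * C₁ * C₂ * (n + 1))) (fun w => ∑ m, B (f m w) (g m w)) := by
  induction k generalizing S T V₁ V₂ V₃ with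
  | zero =>
    intro w
    have hK : 0 ≤ K := (norm_nonneg B).trans hB
    calc ‖∑ m, B (f m w) (g m w)‖ ≤ ∑ m, ‖B (f m w) (g m w)‖ := norm_sum_le _ _
      _ ≤ ∑ m, K * C₁ * C₂ * (omegaN (insert m S) * omegaN (insert m T)) := by
        refine Finset.sum_le_sum fun m _ => ?_
        refine (B.le_opNorm₂ _ _).trans ?_
        have h1 := (hf m).bound w
        have h2 := (hg m).bound w
        calc ‖B‖ * ‖f m w‖ * ‖g m w‖
            ≤ K * (C₁ * omegaN (insert m S)) * (C₂ * omegaN (insert m T)) := by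
              have := omegaN_nonneg (insert m S)
              gcongr
          _ = _ := by ring
      _ = K * C₁ * C₂ * ∑ m, (omegaN (insert m S) * omegaN (insert m T)) := by
        rw [Finset.mul_sum]
      _ ≤ K * C₁ * C₂ * (((S.card + T.card + 1 : ℕ) : ℝ) * omegaN (S ∪ T)) := by
        gcongr
        exact sum_omegaN_insert_mul_le S T
      _ ≤ K * C₁ * C₂ * ((n + 1) * omegaN (S ∪ T)) := by
        have := omegaN_nonneg (S ∪ T)
        gcongr
        exact_mod_cast (by omega : S.card + T.card + 1 ≤ n + 1)
      _ = _ := by ring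
  | succ k ih =>
    have h0 := ih (by omega) B hB (fun m => (hf m).of_succ) (fun m => (hg m).of_succ)
    have hK : 0 ≤ K := (norm_nonneg B).trans hB
    refine ⟨fun w => (h0.bound w).trans ?_, ?_, fun j => ?_⟩
    · have := omegaN_nonneg (S ∪ T)
      gcongr
      · norm_num
      · omega
    · have hd : ∀ m, Differentiable ℝ fun w => B (f m w) (g m w) := fun m w =>
        (B.hasFDerivAt_of_bilinear ((hf m).2.1 w).hasFDerivAt
          ((hg m).2.1 w).hasFDerivAt).differentiableAt
      exact Differentiable.fun_sum fun m _ => hd m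
    · have hd : ∀ m, Differentiable ℝ fun w => B (f m w) (g m w) := fun m w =>
        (B.hasFDerivAt_of_bilinear ((hf m).2.1 w).hasFDerivAt
          ((hg m).2.1 w).hasFDerivAt).differentiableAt
      have heq : blockDeriv E j (fun w => ∑ m, B (f m w) (g m w)) = fun w =>
          (∑ m, B.precompR Q (f m w) (blockDeriv E j (g m) w)) +
            ∑ m, B.precompL Q (blockDeriv E j (f m) w) (g m w) := by
        funext w
        rw [← Finset.sum_add_distrib]
        have h1 : blockDeriv E j (fun w => ∑ m, B (f m w) (g m w)) w =
            ∑ m, blockDeriv E j (fun w => B (f m w) (g m w)) w := by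
          simp only [blockDeriv]
          rw [fderiv_fun_sum fun m _ => hd m w]
          ext; simp
        rw [h1]
        refine Finset.sum_congr rfl fun m _ => ?_
        rw [blockDeriv_bilinear B (hf m).2.1 (hg m).2.1 j]
      rw [heq]
      have hins : ∀ m (R : Finset (Fin N)), insert j (insert m R) = insert m (insert j R) :=
        fun m R => Finset.insert_comm _ _ _
      have hcard : ∀ R : Finset (Fin N), (insert j R).card ≤ R.card + 1 := fun R =>
        Finset.card_insert_le _ _
      have hS := hcard S
      have hT := hcard T
      have e1 := ih (S := S) (T := insert j T) (by omega) (B.precompR Q)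
        ((B.norm_precompR_le Q).trans hB) (fun m => (hf m).of_succ)
        (fun m => hins m T ▸ (hg m).2.2 j)
      have e2 := ih (S := insert j S) (T := T) (by omega) (B.precompL Q)
        ((B.norm_precompL_le Q).trans hB) (fun m => hins m S ▸ (hf m).2.2 j)
        (fun m => (hg m).of_succ)
      rw [Finset.union_insert] at e1
      rw [Finset.insert_union] at e2
      refine (e1.add e2).mono (le_of_eq ?_)
      ring

/-- The chain rule: if the block derivatives of the blocks `y m` of the inner map are attached to
`{m, j}`, composition with the inner map preserves the class of a function. -/
theorem exists_omegaClass_comp (k n : ℕ) (C₁ C₂ : ℝ) (hC₁ : 0 ≤ C₁) (hC₂ : 0 ≤ C₂) :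
    ∃ C : ℝ, C₁ ≤ C ∧ ∀ {N : ℕ} [NeZero N] {W : Type} [NormedAddCommGroup W]
      [NormedSpace ℝ W] {E : Fin N → Q →L[ℝ] W} (S : Finset (Fin N)) {V : Type}
      [NormedAddCommGroup V] [NormedSpace ℝ V] (f : W → V) (φ : W → W) (y : Fin N → W → Q),
      S.card + k ≤ n → Differentiable ℝ φ →
      (∀ j w, (fderiv ℝ φ w).comp (E j) = ∑ m, (E m).comp (blockDeriv E j (y m) w)) →
      (∀ m j, OmegaClass E (k - 1) {m, j} C₂ (blockDeriv E j (y m))) →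
      OmegaClass E k S C₁ f → OmegaClass E k S C (fun w => f (φ w)) := by
  induction k with
  | zero =>
    refine ⟨C₁, le_rfl, ?_⟩
    intro N _ W _ _ E S V _ _ f φ y _ _ _ _ hf w
    exact hf (φ w)
  | succ k ih =>
    obtain ⟨C, hC, h⟩ := ih
    have hC0 : 0 ≤ C := hC₁.trans hC
    refine ⟨max C₁ (2 ^ k * (1 * C * C₂ * (n + 1 + 1))), le_max_left _ _, ?_⟩
    intro N _ W _ _ E S V _ _ f φ y hn hφ hE hy hf
    refine ⟨fun w => (hf.1 (φ w)).trans ?_, hf.2.1.comp hφ, fun j => ?_⟩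
    · exact mul_le_mul_of_nonneg_right (le_max_left _ _) (omegaN_nonneg _)
    have heq : blockDeriv E j (fun w => f (φ w)) = fun w =>
        ∑ m, ContinuousLinearMap.compL ℝ Q Q V (blockDeriv E m f (φ w))
          (blockDeriv E j (y m) w) := by
      funext w
      simp only [blockDeriv]
      rw [fderiv_fun_comp w (hf.2.1 _) (hφ w), ContinuousLinearMap.comp_assoc, hE]
      ext q
      simp [blockDeriv]
    rw [heq]
    have hcard : ∀ m, (insert m S).card ≤ S.card + 1 := fun m => Finset.card_insert_le _ _
    have e := OmegaClass.sum_bilinear (k := k) (n := n + 1) (S := S) (T := {j}) (E := E)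
      (C₁ := C) (C₂ := C₂) (K := 1) hC0 hC₂ (by simp; omega) (ContinuousLinearMap.compL ℝ Q Q V)
      (ContinuousLinearMap.norm_compL_le ℝ Q Q V)
      (f := fun m w => blockDeriv E m f (φ w)) (g := fun m => blockDeriv E j (y m))
      (fun m => h (insert m S) _ φ y (by have := hcard m; omega) hφ hE
        (fun m j => (hy m j).of_le (by omega)) (hf.2.2 m))
      (fun m => hy m j)
    have hu : S ∪ {j} = insert j S := by ext; simp
    rw [hu] at e
    refine e.mono ?_
    push_cast
    exact le_max_right _ _

/-- The linear system `∑ₘ B (A i m) (v m) = b i` with right-hand side of size `ω_{S ∪ {i}}` has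
only solutions of size `ω_{S ∪ {i}}`, if `S` has at most `n` elements. The action `B` of the
coefficients on the unknowns is arbitrary, since unknowns will be operators of any order. -/
def OmegaSolvable (n : ℕ) (K : ℝ) (A : Fin N → Fin N → V₁) (B : V₁ →L[ℝ] V₂ →L[ℝ] V₃) : Prop :=
  ∀ (S : Finset (Fin N)) (v : Fin N → V₂) (β : ℝ), S.card ≤ n → 0 ≤ β →
    (∀ i, ‖∑ m, B (A i m) (v m)‖ ≤ β * omegaN (insert i S)) →
    ∀ i, ‖v i‖ ≤ K * β * omegaN (insert i S)

theorem OmegaSolvable.precompR {n : ℕ} {K : ℝ} (hK : 0 ≤ K) {A : Fin N → Fin N → V₁}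
    {B : V₁ →L[ℝ] V₂ →L[ℝ] V₃} (h : OmegaSolvable n K A B) (Q : Type) [NormedAddCommGroup Q]
    [NormedSpace ℝ Q] : OmegaSolvable n K A (B.precompR Q) := by
  intro S v β hS hβ hb i
  have h0 := fun i => omegaN_nonneg (insert i S)
  refine ContinuousLinearMap.opNorm_le_bound _
    (mul_nonneg (mul_nonneg hK hβ) (h0 i)) fun q => ?_
  have := h S (fun m => v m q) (β * ‖q‖) hS (by positivity) (fun i => by
    have h1 := (∑ m, B.precompR Q (A i m) (v m)).le_of_opNorm_le (hb i) q
    rw [sum_apply] at h1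
    refine h1.trans (le_of_eq ?_)
    ring) i
  refine this.trans (le_of_eq ?_)
  ring

theorem OmegaSolvable.compL {n : ℕ} {K : ℝ} (hK : 0 ≤ K) {A : Fin N → Fin N → V₁ →L[ℝ] V₂}
    (h : OmegaSolvable n K A (ContinuousLinearMap.id ℝ (V₁ →L[ℝ] V₂))) (Q : Type)
    [NormedAddCommGroup Q] [NormedSpace ℝ Q] :
    OmegaSolvable n K A (ContinuousLinearMap.compL ℝ Q V₁ V₂) :=
  fun S v β hS hβ hb => h.precompR hK Q S v β hS hβ hb

/-- The solution of a linear system, whose coefficients are attached to `{i, m}` and whose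
right-hand side is attached to `{i} ∪ S`, is attached to `{i} ∪ S`: the derivatives of the solution
solve the same system with a new right-hand side. -/
theorem exists_omegaClass_solution (k n : ℕ) (C₁ C₂ K : ℝ) (hC₁ : 0 ≤ C₁) (hC₂ : 0 ≤ C₂)
    (hK : 0 ≤ K) :
    ∃ C : ℝ, 0 ≤ C ∧ ∀ {N : ℕ} [NeZero N] {W : Type} [NormedAddCommGroup W]
      [NormedSpace ℝ W] {E : Fin N → Q →L[ℝ] W} {V₁ V₂ V₃ : Type}
      [NormedAddCommGroup V₁] [NormedSpace ℝ V₁] [NormedAddCommGroup V₂] [NormedSpace ℝ V₂]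
      [NormedAddCommGroup V₃] [NormedSpace ℝ V₃] (B : V₁ →L[ℝ] V₂ →L[ℝ] V₃)
      (S : Finset (Fin N)) (A : Fin N → Fin N → W → V₁) (u : Fin N → W → V₂)
      (b : Fin N → W → V₃),
      ‖B‖ ≤ 1 → S.card + k ≤ n → (∀ i, ContDiff ℝ k (u i)) →
      (∀ w, OmegaSolvable n K (fun i m => A i m w) B) →
      (∀ i m, OmegaClass E k {i, m} C₁ (A i m)) →
      (∀ i, OmegaClass E k (insert i S) C₂ (b i)) →
      (∀ i w, ∑ m, B (A i m w) (u m w) = b i w) →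
      ∀ i, OmegaClass E k (insert i S) C (u i) := by
  induction k generalizing C₂ with
  | zero =>
    refine ⟨K * C₂, by positivity, ?_⟩
    intro N _ W _ _ E V₁ V₂ V₃ _ _ _ _ _ _ B S A u b _ hS _ hA _ hb heq i w
    exact hA w S (fun m => u m w) C₂ (by omega) hC₂ (fun i => by rw [heq]; exact hb i w) i
  | succ k ih =>
    obtain ⟨C, hC, h⟩ := ih C₂ hC₂
    obtain ⟨C', hC', h'⟩ := ih (C₂ + 2 ^ k * (1 * C₁ * C * (n + 3 + 1))) (by positivity)
    refine ⟨max C C', le_max_of_le_left hC, ?_⟩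
    intro N _ W _ _ E V₁ V₂ V₃ _ _ _ _ _ _ B S A u b hB hS hu hA hA1 hb heq
    have hcard : ∀ (j : Fin N) (R : Finset (Fin N)), (insert j R).card ≤ R.card + 1 := fun j R =>
      Finset.card_insert_le _ _
    have hud : ∀ i, Differentiable ℝ (u i) := fun i =>
      (hu i).differentiable (by simp)
    have hk : ∀ i, OmegaClass E k (insert i S) C (u i) :=
      h B S A u b hB (by omega) (fun i => (hu i).of_le (by exact_mod_cast Nat.le_succ k)) hA
        (fun i m => (hA1 i m).of_succ) (fun i => (hb i).of_succ) heq
    intro i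
    refine ⟨fun w => ((hk i).bound w).trans ?_, hud i, fun j => ?_⟩
    · exact mul_le_mul_of_nonneg_right (le_max_left _ _) (omegaN_nonneg _)
    rw [Finset.insert_comm]
    refine OmegaClass.mono ?_ (le_max_right C C')
    refine h' (B.precompR Q) (insert j S) A (fun m => blockDeriv E j (u m))
      (fun i w => blockDeriv E j (b i) w +
        -∑ m, B.precompL Q (blockDeriv E j (A i m) w) (u m w))
      ((B.norm_precompR_le Q).trans hB) (by have := hcard j S; omega) (fun m => ?_)
      (fun w => (hA w).precompR hK Q) (fun i m => (hA1 i m).of_succ) (fun i => ?_)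
      (fun i w => ?_) i
    · have : ContDiff ℝ k (fderiv ℝ (u m)) :=
        (hu m).fderiv_right (by push_cast; exact le_rfl)
      exact this.clm_comp contDiff_const
    · refine OmegaClass.add ?_ (OmegaClass.neg ?_)
      · rw [Finset.insert_comm]
        exact (hb i).2.2 j
      · have e := OmegaClass.sum_bilinear (k := k) (n := n + 3) (S := {i, j}) (T := S) (E := E)
          (C₁ := C₁) (C₂ := C) (K := 1) hC₁ hC (by have := hcard i {j}; simp at this; omega)
          (B.precompL Q) ((B.norm_precompL_le Q).trans hB)
          (f := fun m => blockDeriv E j (A i m)) (g := fun m => u m)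
          (fun m => by
            have h2 := (hA1 i m).2.2 j
            have h3 : insert j {i, m} = (insert m {i, j} : Finset (Fin N)) := by
              ext; simp; tauto
            rwa [h3] at h2)
          hk
        have hu : {i, j} ∪ S = insert i (insert j S) := by ext; simp
        rw [hu] at e
        exact_mod_cast e
    · have h1 : blockDeriv E j (fun w => ∑ m, B (A i m w) (u m w)) w =
          ∑ m, blockDeriv E j (fun w => B (A i m w) (u m w)) w := by
        simp only [blockDeriv]
        rw [fderiv_fun_sum fun m _ => (B.hasFDerivAt_of_bilinear ((hA1 i m).2.1 w).hasFDerivAt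
          (hud m w).hasFDerivAt).differentiableAt]
        ext; simp
      have h2 : (fun w => ∑ m, B (A i m w) (u m w)) = b i := funext fun w => heq i w
      rw [← h2, h1, eq_add_neg_iff_add_eq, ← Finset.sum_add_distrib]
      refine Finset.sum_congr rfl fun m _ => ?_
      rw [blockDeriv_bilinear B (hA1 i m).2.1 (hud m) j]

end OmegaClass

/-! ### Linear systems with small off-diagonal blocks -/

section LinearSystem

theorem sum_sq_le_of_mul_sum_sq_le {ι : Type} (T : Finset ι) {x y : ι → ℝ} {c : ℝ} (hc : 0 < c)
    (h : c * ∑ i ∈ T, x i ^ 2 ≤ ∑ i ∈ T, y i * x i) :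
    c ^ 2 * ∑ i ∈ T, x i ^ 2 ≤ ∑ i ∈ T, y i ^ 2 := by
  have hX : 0 ≤ ∑ i ∈ T, x i ^ 2 := Finset.sum_nonneg fun i _ => sq_nonneg _
  have hY : 0 ≤ ∑ i ∈ T, y i ^ 2 := Finset.sum_nonneg fun i _ => sq_nonneg _
  have hCS := Finset.sum_mul_sq_le_sq_mul_sq T y x
  rcases hX.eq_or_lt with h0 | h0
  · rw [← h0]; simpa using hY
  · refine le_of_mul_le_mul_right ?_ h0
    refine le_trans ?_ hCS
    calc c ^ 2 * (∑ i ∈ T, x i ^ 2) * ∑ i ∈ T, x i ^ 2 = (c * ∑ i ∈ T, x i ^ 2) ^ 2 := by ring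
      _ ≤ _ := pow_le_pow_left₀ (by positivity) h 2

/-- A coercive system with bounded diagonal blocks and off-diagonal blocks of size `1/N` can be
solved in the weighted sense. The unknowns in `S` are controlled by the `ℓ²` estimate; those
outside `S` solve a coercive system, whose right-hand side has entries of size `ω_S / N`, and
averaging over the blocks turns its `ℓ²` estimate into a bound on each entry. -/
theorem exists_omegaSolvable_of_coercive (n : ℕ) (c C₁ : ℝ) (hc : 0 < c) (hC₁ : 0 ≤ C₁) :
    ∃ K : ℝ, 0 ≤ K ∧ ∀ {N : ℕ} [NeZero N] {H : Type} [NormedAddCommGroup H] [NormedSpace ℝ H]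
      (A : Fin N → Fin N → H →L[ℝ] H →L[ℝ] ℝ),
      (∀ i m, ‖A i m‖ ≤ C₁ * omegaN {i, m}) →
      (∀ ξ : Fin N → H, c * ∑ i, ‖ξ i‖ ^ 2 ≤ ∑ i, ∑ m, A i m (ξ m) (ξ i)) →
      OmegaSolvable n K A (ContinuousLinearMap.id ℝ (H →L[ℝ] H →L[ℝ] ℝ)) := by
  -- `K₁` bounds the unknowns in `S`, `K₂ / N` the right-hand side of the system for the unknowns
  -- outside `S`, and `K₃ / N` these unknowns
  set K₁ : ℝ := (n + 1) / c with hK₁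
  have hK₁0 : 0 ≤ K₁ := by positivity
  set K₂ : ℝ := 1 + n * C₁ * K₁ with hK₂
  have hK₂0 : 0 ≤ K₂ := by positivity
  set K₃ : ℝ := K₂ * (1 + C₁ / c) / c with hK₃
  have hK₃0 : 0 ≤ K₃ := by positivity
  refine ⟨K₁ + K₃, by positivity, ?_⟩
  intro N _ H _ _ A hA hco S v β hS hβ hb
  simp only [ContinuousLinearMap.coe_id', id_eq] at hb
  have hN1 : (1 : ℝ) ≤ N := one_le_natCast_of_neZero
  have hN : (0 : ℝ) < N := zero_lt_one.trans_le hN1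
  set s := omegaN S with hs
  have hs0 : 0 ≤ s := omegaN_nonneg S
  have hSn : (S.card : ℝ) ≤ n := by exact_mod_cast hS
  have hin : ∀ i ∈ S, omegaN (insert i S) = s := fun i hi => by rw [Finset.insert_eq_of_mem hi]
  have hout : ∀ i ∉ S, omegaN (insert i S) = s / N := fun i hi => omegaN_insert_of_notMem hi
  -- the global `ℓ²` estimate
  have hb2 : ∀ i, ‖∑ m, A i m (v m)‖ ^ 2 ≤
      (if i ∈ S then (β * s) ^ 2 else 0) + (β * s) ^ 2 / N := by
    intro i
    split_ifs with hi
    · have h1 := hb i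
      rw [hin i hi] at h1
      have h2 := pow_le_pow_left₀ (norm_nonneg _) h1 2
      have : 0 ≤ (β * s) ^ 2 / N := by positivity
      linarith
    · have h1 := hb i
      rw [hout i hi] at h1
      have h2 := pow_le_pow_left₀ (norm_nonneg _) h1 2
      rw [zero_add]
      refine h2.trans ?_
      rw [mul_div_assoc', div_pow]
      exact div_le_div_of_nonneg_left (by positivity) hN (by nlinarith)
  have h1 : c ^ 2 * ∑ i, ‖v i‖ ^ 2 ≤ (n + 1) * (β * s) ^ 2 := by
    have h2 : c * ∑ i, ‖v i‖ ^ 2 ≤ ∑ i, ‖∑ m, A i m (v m)‖ * ‖v i‖ := by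
      refine (hco v).trans (Finset.sum_le_sum fun i _ => ?_)
      rw [← sum_apply]
      exact (Real.le_norm_self _).trans (ContinuousLinearMap.le_opNorm _ _)
    refine (sum_sq_le_of_mul_sum_sq_le _ hc h2).trans ?_
    refine (Finset.sum_le_sum fun i _ => hb2 i).trans ?_
    rw [Finset.sum_add_distrib, Finset.sum_const, ← Finset.sum_filter, Finset.sum_const,
      Finset.card_univ, Fintype.card_fin, nsmul_eq_mul, nsmul_eq_mul, mul_div_cancel₀ _ hN.ne',
      Finset.filter_mem_eq_inter, Finset.univ_inter]
    nlinarith [sq_nonneg (β * s)]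
  have hv1 : ∀ i, ‖v i‖ ≤ K₁ * (β * s) := by
    intro i
    have h2 : c ^ 2 * ‖v i‖ ^ 2 ≤ (n + 1) * (β * s) ^ 2 := by
      refine le_trans ?_ h1
      have := Finset.single_le_sum (f := fun i => ‖v i‖ ^ 2) (fun i _ => sq_nonneg _)
        (Finset.mem_univ i)
      gcongr
    have h3 : (c * ‖v i‖) ^ 2 ≤ ((n + 1) * (β * s)) ^ 2 := by
      have h4 : ((n : ℝ) + 1) * (β * s) ^ 2 ≤ (n + 1) ^ 2 * (β * s) ^ 2 := by
        have : (0 : ℝ) ≤ n := Nat.cast_nonneg n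
        gcongr
        nlinarith
      nlinarith
    have h5 := abs_le_of_sq_le_sq h3 (by positivity)
    rw [hK₁, div_mul_eq_mul_div, le_div_iff₀ hc]
    linarith [le_abs_self (c * ‖v i‖)]
  -- the system for the unknowns outside `S`
  have hb' : ∀ i ∉ S, ‖∑ m ∈ Sᶜ, A i m (v m)‖ ≤ K₂ * (β * s) / N := by
    intro i hi
    have h2 : ∑ m ∈ Sᶜ, A i m (v m) = ∑ m, A i m (v m) - ∑ m ∈ S, A i m (v m) := by
      rw [eq_sub_iff_add_eq, add_comm, Finset.sum_add_sum_compl]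
    rw [h2]
    have h3 : ‖∑ m ∈ S, A i m (v m)‖ ≤ n * (C₁ / N * (K₁ * (β * s))) := by
      refine (norm_sum_le _ _).trans ?_
      refine (Finset.sum_le_card_nsmul _ _ (C₁ / N * (K₁ * (β * s))) fun m hm => ?_).trans ?_
      · have hne : i ≠ m := fun h => hi (h ▸ hm)
        have h4 := hA i m
        rw [omegaN_pair_of_ne hne, ← div_eq_mul_inv] at h4
        exact (A i m).le_of_opNorm_le_of_le h4 (hv1 m)
      · rw [nsmul_eq_mul]
        gcongr
    have h4 := hb i
    rw [hout i hi] at h4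
    refine (norm_sub_le _ _).trans ((add_le_add h4 h3).trans (le_of_eq ?_))
    rw [hK₂]
    field_simp
  have h2 : c ^ 2 * ∑ i ∈ Sᶜ, ‖v i‖ ^ 2 ≤ (K₂ * (β * s)) ^ 2 / N := by
    have h3 : c * ∑ i ∈ Sᶜ, ‖v i‖ ^ 2 ≤ ∑ i ∈ Sᶜ, (K₂ * (β * s) / N) * ‖v i‖ := by
      have h4 := hco fun i => if i ∈ Sᶜ then v i else 0
      have h5 : ∑ i, ‖(if i ∈ Sᶜ then v i else 0)‖ ^ 2 = ∑ i ∈ Sᶜ, ‖v i‖ ^ 2 := by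
        rw [← Finset.sum_filter_add_sum_filter_not Finset.univ (fun i => i ∈ Sᶜ)]
        rw [Finset.sum_congr rfl (g := fun i => ‖v i‖ ^ 2)
          (fun i hi => by rw [if_pos (Finset.mem_filter.1 hi).2]),
          Finset.sum_eq_zero (s := Finset.univ.filter fun i => ¬ i ∈ Sᶜ)
          (fun i hi => by rw [if_neg (Finset.mem_filter.1 hi).2]; simp)]
        rw [add_zero, Finset.filter_mem_eq_inter, Finset.univ_inter]
      have h6 : ∑ i, ∑ m, A i m (if m ∈ Sᶜ then v m else 0) (if i ∈ Sᶜ then v i else 0) =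
          ∑ i ∈ Sᶜ, (∑ m ∈ Sᶜ, A i m (v m)) (v i) := by
        rw [← Finset.sum_filter_add_sum_filter_not Finset.univ (fun i => i ∈ Sᶜ)]
        rw [Finset.sum_eq_zero (s := Finset.univ.filter fun i => ¬ i ∈ Sᶜ)
          (fun i hi => by simp only [if_neg (Finset.mem_filter.1 hi).2]; simp)]
        rw [add_zero, Finset.filter_mem_eq_inter, Finset.univ_inter]
        refine Finset.sum_congr rfl fun i hi => ?_
        rw [if_pos hi, ← sum_apply]
        congr 1
        rw [← Finset.sum_filter_add_sum_filter_not Finset.univ (fun i => i ∈ Sᶜ)]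
        rw [Finset.sum_congr rfl (g := fun m => A i m (v m))
          (fun i hi => by rw [if_pos (Finset.mem_filter.1 hi).2]),
          Finset.sum_eq_zero (s := Finset.univ.filter fun i => ¬ i ∈ Sᶜ)
          (fun i hi => by rw [if_neg (Finset.mem_filter.1 hi).2]; simp)]
        rw [add_zero, Finset.filter_mem_eq_inter, Finset.univ_inter]
      rw [h5, h6] at h4
      refine h4.trans (Finset.sum_le_sum fun i hi => ?_)
      exact (Real.le_norm_self _).trans
        (ContinuousLinearMap.le_of_opNorm_le _ (hb' i (Finset.mem_compl.1 hi)) _)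
    refine (sum_sq_le_of_mul_sum_sq_le _ hc h3).trans ?_
    rw [Finset.sum_const, nsmul_eq_mul]
    have : ((Sᶜ.card : ℕ) : ℝ) ≤ N := by
      have := Finset.card_le_univ Sᶜ
      rw [Fintype.card_fin] at this
      exact_mod_cast this
    calc (Sᶜ.card : ℝ) * (K₂ * (β * s) / N) ^ 2 ≤ N * (K₂ * (β * s) / N) ^ 2 := by gcongr
      _ = _ := by field_simp
  -- `∑ ‖v i‖` is bounded by Cauchy-Schwarz, since the `ℓ²` norm is of size `N^{-1/2}`
  have h3 : ∑ i ∈ Sᶜ, ‖v i‖ ≤ K₂ * (β * s) / c := by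
    have h4 := sq_sum_le_card_mul_sum_sq (s := Sᶜ) (f := fun i => ‖v i‖)
    have h5 : ((Sᶜ.card : ℕ) : ℝ) ≤ N := by
      have := Finset.card_le_univ Sᶜ
      rw [Fintype.card_fin] at this
      exact_mod_cast this
    have h6 : (0 : ℝ) ≤ ∑ i ∈ Sᶜ, ‖v i‖ ^ 2 := Finset.sum_nonneg fun i _ => sq_nonneg _
    have h7 : (c * ∑ i ∈ Sᶜ, ‖v i‖) ^ 2 ≤ (K₂ * (β * s)) ^ 2 := by
      rw [le_div_iff₀ hN] at h2
      calc (c * ∑ i ∈ Sᶜ, ‖v i‖) ^ 2 = c ^ 2 * (∑ i ∈ Sᶜ, ‖v i‖) ^ 2 := by ring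
        _ ≤ c ^ 2 * (N * ∑ i ∈ Sᶜ, ‖v i‖ ^ 2) := by
          gcongr
          exact h4.trans (mul_le_mul_of_nonneg_right h5 h6)
        _ ≤ _ := by linarith
    have h8 := abs_le_of_sq_le_sq h7 (by positivity)
    rw [le_div_iff₀ hc]
    linarith [le_abs_self (c * ∑ i ∈ Sᶜ, ‖v i‖)]
  intro i
  by_cases hi : i ∈ S
  · rw [hin i hi]
    refine (hv1 i).trans ?_
    have : 0 ≤ K₃ * β * s := by positivity
    nlinarith
  · rw [hout i hi]
    -- coercivity of the diagonal block; the other blocks act on `v` as an average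
    have h4 : c * ‖v i‖ ^ 2 ≤ (K₂ * (β * s) / N + C₁ / N * (K₂ * (β * s) / c)) * ‖v i‖ := by
      have h5 := hco (Pi.single i (v i))
      have h6 : ∑ j, ‖(Pi.single i (v i) : Fin N → H) j‖ ^ 2 = ‖v i‖ ^ 2 := by
        rw [Finset.sum_eq_single i]
        · simp
        · intro j _ hj; simp [hj]
        · simp
      have h7 : ∑ j, ∑ m, A j m ((Pi.single i (v i) : Fin N → H) m)
          ((Pi.single i (v i) : Fin N → H) j) = A i i (v i) (v i) := by
        rw [Finset.sum_eq_single i, Finset.sum_eq_single i]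
        · simp
        · intro j _ hj; simp [hj]
        · simp
        · intro j _ hj; simp [hj]
        · simp
      rw [h6, h7] at h5
      have hic : i ∈ Sᶜ := Finset.mem_compl.2 hi
      have h8 : A i i (v i) = ∑ m ∈ Sᶜ, A i m (v m) - ∑ m ∈ Sᶜ.erase i, A i m (v m) := by
        rw [← Finset.add_sum_erase _ _ hic]; abel
      have h9 : ‖∑ m ∈ Sᶜ.erase i, A i m (v m)‖ ≤ C₁ / N * (K₂ * (β * s) / c) := by
        calc ‖∑ m ∈ Sᶜ.erase i, A i m (v m)‖ ≤ ∑ m ∈ Sᶜ.erase i, C₁ / N * ‖v m‖ := by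
              refine (norm_sum_le _ _).trans (Finset.sum_le_sum fun m hm => ?_)
              have h4 := hA i m
              rw [omegaN_pair_of_ne (Finset.ne_of_mem_erase hm).symm, ← div_eq_mul_inv] at h4
              exact (A i m).le_of_opNorm_le h4 (v m)
          _ ≤ ∑ m ∈ Sᶜ, C₁ / N * ‖v m‖ :=
              Finset.sum_le_sum_of_subset_of_nonneg (Finset.erase_subset _ _)
                fun m _ _ => by positivity
          _ ≤ _ := by rw [← Finset.mul_sum]; gcongr
      refine h5.trans ?_
      refine (Real.le_norm_self _).trans (ContinuousLinearMap.le_of_opNorm_le _ ?_ _)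
      rw [h8]
      exact (norm_sub_le _ _).trans (add_le_add (hb' i hi) h9)
    have h5 : ‖v i‖ ≤ K₃ * (β * s) / N := by
      rcases (norm_nonneg (v i)).eq_or_lt with h0 | h0
      · rw [← h0]; positivity
      · have h6 : c * ‖v i‖ ≤ K₂ * (β * s) / N + C₁ / N * (K₂ * (β * s) / c) :=
          le_of_mul_le_mul_right (by linarith) h0
        have h7 : ‖v i‖ ≤ (K₂ * (β * s) / N + C₁ / N * (K₂ * (β * s) / c)) / c := by
          rw [le_div_iff₀ hc]; linarith
        refine h7.trans (le_of_eq ?_)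
        rw [hK₃]
        field_simp
    refine h5.trans ?_
    have : 0 ≤ K₁ * β * (s / N) := by positivity
    have h6 : K₃ * (β * s) / N = K₃ * β * (s / N) := by ring
    rw [h6]
    nlinarith

end LinearSystem

/-! ### Finitely supported measures -/

section WeightedDirac

variable {ι : Type} [Fintype ι]

/-- The measure `∑ⱼ pⱼ δ_{yⱼ}`. -/
def weightedDirac {X : Type} [MeasurableSpace X] (p : ι → ℝ≥0∞) (y : ι → X) : Measure X :=
  ∑ j, p j • Measure.dirac (y j)

section

variable {X Y : Type} [MeasurableSpace X] [MeasurableSpace Y] (p : ι → ℝ≥0∞) (y : ι → X)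

theorem weightedDirac_apply {s : Set X} (hs : MeasurableSet s) :
    weightedDirac p y s = ∑ j, p j * s.indicator 1 (y j) := by
  simp [weightedDirac, Measure.finsetSum_apply, hs]

theorem weightedDirac_univ : weightedDirac p y Set.univ = ∑ j, p j := by
  simp [weightedDirac_apply]

theorem map_weightedDirac {f : X → Y} (hf : Measurable f) :
    (weightedDirac p y).map f = weightedDirac p (fun j => f (y j)) := by
  ext s hs
  rw [Measure.map_apply hf hs, weightedDirac_apply _ _ (hf hs), weightedDirac_apply _ _ hs]
  rfl

variable [MeasurableSingletonClass X]

theorem lintegral_weightedDirac (f : X → ℝ≥0∞) :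
    ∫⁻ x, f x ∂weightedDirac p y = ∑ j, p j * f (y j) := by
  simp [weightedDirac, lintegral_finsetSum_measure]

theorem integral_weightedDirac {G : Type} [NormedAddCommGroup G] [NormedSpace ℝ G]
    [CompleteSpace G] (hp : ∀ j, p j ≠ ∞) (f : X → G) :
    ∫ x, f x ∂weightedDirac p y = ∑ j, (p j).toReal • f (y j) := by
  rw [weightedDirac, integral_finsetSum_measure]
  · simp [integral_smul_measure]
  · intro j _
    exact (integrable_dirac (by simp)).smul_measure (hp j)

theorem ae_weightedDirac {P : X → Prop} (h : ∀ j, P (y j)) : ∀ᵐ x ∂weightedDirac p y, P x := by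
  have h1 : (weightedDirac p y) (Set.range y)ᶜ = 0 := by
    rw [weightedDirac_apply _ _ (Set.finite_range y).measurableSet.compl]
    simp
  refine measure_mono_null (fun x hx => ?_) h1
  rintro ⟨j, rfl⟩
  exact hx (h j)

end

variable {F : Type} [NormedAddCommGroup F] [MeasurableSpace F] [MeasurableSingletonClass F]
  {p : ι → ℝ≥0∞}

theorem weight_le_one (hp : ∑ j, p j = 1) (j : ι) : p j ≤ 1 := by
  rw [← hp]
  exact Finset.single_le_sum (f := p) (fun _ _ => zero_le) (Finset.mem_univ j)

theorem weight_ne_top (hp : ∑ j, p j = 1) (j : ι) : p j ≠ ∞ :=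
  ((weight_le_one hp j).trans_lt ENNReal.one_lt_top).ne

/-- The measure `∑ⱼ pⱼ δ_{yⱼ}` as an element of `P2 F`, if the weights sum up to one. -/
def weightedP2 (hp : ∑ j, p j = 1) (y : ι → F) : P2 F :=
  ⟨weightedDirac p y, ⟨by rw [weightedDirac_univ, hp]⟩, by
    rw [lintegral_weightedDirac]
    exact ENNReal.sum_lt_top.2 fun j _ => ENNReal.mul_lt_top
      (weight_ne_top hp j).lt_top (ENNReal.pow_lt_top enorm_lt_top)⟩

theorem IsCoupling.wassersteinDist_le {F : Type} [NormedAddCommGroup F] [MeasurableSpace F]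
    {π : Measure (F × F)} {μ ν : P2 F} (h : IsCoupling π μ ν) {q : ℝ≥0∞} :
    wassersteinDist q μ ν ≤ eLpNorm (fun y => y.1 - y.2) q π :=
  iInf₂_le π h

theorem isCoupling_weightedDirac (hp : ∑ j, p j = 1) (y y' : ι → F) :
    IsCoupling (weightedDirac p fun j => (y j, y' j)) (weightedP2 hp y) (weightedP2 hp y') :=
  ⟨map_weightedDirac _ _ measurable_fst, map_weightedDirac _ _ measurable_snd⟩

theorem wassersteinDist_one_weightedP2_le (hp : ∑ j, p j = 1) (y y' : ι → F) :
    wassersteinDist 1 (weightedP2 hp y) (weightedP2 hp y') ≤ ∑ j, p j * ‖y j - y' j‖ₑ := by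
  refine (isCoupling_weightedDirac hp y y').wassersteinDist_le.trans ?_
  rw [eLpNorm_one_eq_lintegral_enorm, lintegral_weightedDirac]

theorem eLpNorm_weightedDirac_le (hp : ∑ j, p j = 1) {X V : Type} [MeasurableSpace X]
    [MeasurableSingletonClass X]
    [NormedAddCommGroup V] (y : ι → X) (q : ℝ≥0∞) (f : X → V) (R : ℝ) (h : ∀ j, ‖f (y j)‖ ≤ R) :
    eLpNorm f q (weightedDirac p y) ≤ ENNReal.ofReal R := by
  refine (eLpNorm_le_of_ae_bound (C := R) (ae_weightedDirac p y h)).trans ?_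
  rw [weightedDirac_univ, hp, ENNReal.one_rpow, one_mul]

theorem wassersteinDist_two_weightedP2_le (hp : ∑ j, p j = 1) (y y' : ι → F) :
    wassersteinDist 2 (weightedP2 hp y) (weightedP2 hp y') ≤ ENNReal.ofReal ‖y - y'‖ := by
  refine (isCoupling_weightedDirac hp y y').wassersteinDist_le.trans ?_
  exact eLpNorm_weightedDirac_le hp _ _ _ _ fun j => norm_le_pi_norm (y - y') j

/-- Along finitely supported measures with fixed weights, the Wasserstein derivative yields
the Fréchet derivative in the positions of the atoms. -/
theorem HasWassersteinDerivAt.hasFDerivAt_weightedP2 [NormedSpace ℝ F] {V : Type}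
    [NormedAddCommGroup V] [NormedSpace ℝ V] [CompleteSpace V] {Ψ : P2 F → V} {g : F → F →L[ℝ] V}
    {y : ι → F}
    (hp : ∑ j, p j = 1) (h : HasWassersteinDerivAt Ψ g (weightedP2 hp y)) :
    HasFDerivAt (fun y' => Ψ (weightedP2 hp y'))
      (∑ j, (p j).toReal • (g (y j)).comp (ContinuousLinearMap.proj j : (ι → F) →L[ℝ] F)) y := by
  rw [hasFDerivAt_iff_isLittleO, Asymptotics.isLittleO_iff]
  intro ε hε
  lift ε to ℝ≥0 using hε.le
  obtain ⟨δ, hδ, H⟩ := h.2 ε (by exact_mod_cast hε)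
  filter_upwards [Metric.ball_mem_nhds y (show (0 : ℝ) < δ from hδ)] with y' hy'
  rw [mem_ball_iff_norm] at hy'
  have hle : eLpNorm (fun z : F × F => z.2 - z.1) 2 (weightedDirac p fun j => (y j, y' j)) ≤
      ENNReal.ofReal ‖y' - y‖ :=
    eLpNorm_weightedDirac_le hp _ _ _ _ fun j => norm_le_pi_norm (y' - y) j
  have h1 := H (weightedP2 hp y') _ (isCoupling_weightedDirac hp y y')
    (hle.trans (by
      rw [← ENNReal.ofReal_coe_nnreal]
      exact ENNReal.ofReal_le_ofReal hy'.le))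
  have h2 := h1.trans (mul_le_mul_right hle _)
  rw [integral_weightedDirac _ _ (weight_ne_top hp), ← ofReal_norm,
    ← ENNReal.ofReal_coe_nnreal (p := ε), ← ENNReal.ofReal_mul (NNReal.coe_nonneg _),
    ENNReal.ofReal_le_ofReal_iff (by positivity)] at h2
  refine le_of_eq_of_le ?_ h2
  congr 2
  simp [sum_apply]

end WeightedDirac

/-! ### Smooth functions along finitely supported measures -/

section Smooth

set_option linter.unusedSectionVars false

variable {ι : Type} [Fintype ι] {F : Type} [NormedAddCommGroup F] [NormedSpace ℝ F]
  [MeasurableSpace F] [MeasurableSingletonClass F] {p : ι → ℝ≥0∞} (hp : ∑ j, p j = 1)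
  {W E V : Type} [NormedAddCommGroup W] [NormedSpace ℝ W] [NormedAddCommGroup E] [NormedSpace ℝ E]
  [NormedAddCommGroup V] [NormedSpace ℝ V]

theorem JointlyContinuous.continuous_weightedP2 {Ψ : E → P2 F → V} (h : JointlyContinuous Ψ) :
    Continuous fun z : E × (ι → F) => Ψ z.1 (weightedP2 hp z.2) := by
  rw [Metric.continuous_iff]
  intro z ε hε
  obtain ⟨δ, hδ, H⟩ := h z.1 (weightedP2 hp z.2) ε hε
  refine ⟨δ, hδ, fun z' hz' => ?_⟩
  rw [dist_eq_norm] at hz' ⊢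
  refine H _ _ ((norm_fst_le (z' - z)).trans_lt hz') ?_
  refine (wassersteinDist_two_weightedP2_le hp _ _).trans_lt ?_
  rw [ENNReal.ofReal_lt_ofReal_iff hδ, norm_sub_rev]
  exact (norm_snd_le (z' - z)).trans_lt hz'

/-- The derivative of `w ↦ Ψ (A w, ∑ⱼ pⱼ δ_{(Y w)ⱼ})`. -/
theorem hasFDerivAt_weightedP2 [CompleteSpace V] {Ψ : E → P2 F → V} {Dz : E → P2 F → E →L[ℝ] V}
    {Dμ : E × F → P2 F → F →L[ℝ] V} (hz : ∀ z μ, HasFDerivAt (fun z' => Ψ z' μ) (Dz z μ) z)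
    (hμ : ∀ z μ, HasWassersteinDerivAt (Ψ z) (fun y => Dμ (z, y) μ) μ)
    (hzc : JointlyContinuous Dz) (hμc : JointlyContinuous Dμ)
    (A : W →L[ℝ] E) (Y : W →L[ℝ] (ι → F)) (w : W) :
    HasFDerivAt (fun w => Ψ (A w) (weightedP2 hp (Y w)))
      ((Dz (A w) (weightedP2 hp (Y w))).comp A +
        ∑ j, (p j).toReal • (Dμ (A w, Y w j) (weightedP2 hp (Y w))).comp
          ((ContinuousLinearMap.proj j).comp Y)) w := by
  have hpair : ∀ j, Continuous fun z : E × (ι → F) => Dμ (z.1, z.2 j) (weightedP2 hp z.2) :=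
    fun j => (hμc.continuous_weightedP2 hp).comp
      (g := fun z : (E × F) × (ι → F) => Dμ z.1 (weightedP2 hp z.2))
      (f := fun z : E × (ι → F) => ((z.1, z.2 j), z.2))
      ((continuous_fst.prodMk ((continuous_apply j).comp continuous_snd)).prodMk continuous_snd)
  have h := hasStrictFDerivAt_uncurry_coprod (𝕜 := ℝ) (u := (A w, Y w))
    (f := fun z y => Ψ z (weightedP2 hp y)) (f₁ := fun z y => Dz z (weightedP2 hp y))
    (f₂ := fun z y => ∑ j, (p j).toReal • (Dμ (z, y j) (weightedP2 hp y)).comp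
      (ContinuousLinearMap.proj j : (ι → F) →L[ℝ] F))
    (Filter.Eventually.of_forall fun v => hz v.1 _)
    (Filter.Eventually.of_forall fun v => (hμ v.1 _).hasFDerivAt_weightedP2 hp)
    (hzc.continuous_weightedP2 hp).continuousAt
    (by
      refine Continuous.continuousAt ?_
      exact continuous_finsetSum _ fun j _ =>
        (((hpair j).clm_comp continuous_const).const_smul (p j).toReal))
  have h2 := h.hasFDerivAt.comp w (f := fun w => (A w, Y w)) (A.prod Y).hasFDerivAt
  refine h2.congr_fderiv ?_
  ext v
  simp [Function.HasUncurry.uncurry, sum_apply]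

theorem IsCkBounded.jointlyContinuous {k j : ℕ} {Ψ : E → P2 F → V} (h : IsCkBounded k j Ψ) :
    JointlyContinuous Ψ := by
  cases k with
  | zero => exact h.1
  | succ k => exact h.1

theorem IsCkBounded.exists_bound {k : ℕ} {Ψ : E → P2 F → V} (h : IsCkBounded k 0 Ψ) :
    ∃ C : ℝ, ∀ z μ, ‖Ψ z μ‖ ≤ C := by
  cases k with
  | zero => exact h.2 rfl
  | succ k => exact h.2.1 rfl

theorem IsCkBounded.contDiff_weightedP2 [CompleteSpace V] {k j : ℕ} {Ψ : E → P2 F → V}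
    (h : IsCkBounded k j Ψ) (A : W →L[ℝ] E) (Y : W →L[ℝ] (ι → F)) :
    ContDiff ℝ k fun w => Ψ (A w) (weightedP2 hp (Y w)) := by
  induction k generalizing j E V with
  | zero =>
    rw [Nat.cast_zero, contDiff_zero]
    exact (h.1.continuous_weightedP2 hp).comp (A.continuous.prodMk Y.continuous)
  | succ k ih =>
    obtain ⟨_, _, Dz, Dμ, hz, hμ, hzk, hμk⟩ := h
    push_cast
    rw [contDiff_succ_iff_hasFDerivAt]
    refine ⟨_, ?_, fun w => hasFDerivAt_weightedP2 hp hz hμ hzk.jointlyContinuous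
      hμk.jointlyContinuous A Y w⟩
    refine ((ih hzk A).clm_comp contDiff_const).add (ContDiff.sum fun j _ => ?_)
    exact ((ih hμk (A.prod ((ContinuousLinearMap.proj j).comp Y))).clm_comp
      contDiff_const).const_smul (p j).toReal

end Smooth

/-! ### Smooth functions along the empirical measures of the other players -/

section Others

variable {N : ℕ}

/-- The weights of the empirical measure of all the indices but `i`. -/
def othersWeight (i j : Fin N) : ℝ≥0∞ := if j = i then 0 else ((N - 1 : ℕ) : ℝ≥0∞)⁻¹

theorem sum_othersWeight (hN : 2 ≤ N) (i : Fin N) : ∑ j, othersWeight i j = 1 := by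
  have h0 : ((N - 1 : ℕ) : ℝ≥0∞) ≠ 0 := by
    rw [Nat.cast_ne_zero]; omega
  simp only [othersWeight]
  rw [← Finset.add_sum_erase _ _ (Finset.mem_univ i), if_pos rfl, zero_add,
    Finset.sum_congr rfl (g := fun _ => ((N - 1 : ℕ) : ℝ≥0∞)⁻¹)
      (fun j hj => if_neg (Finset.ne_of_mem_erase hj)),
    Finset.sum_const, Finset.card_erase_of_mem (Finset.mem_univ i), Finset.card_univ,
    Fintype.card_fin, nsmul_eq_mul]
  exact ENNReal.mul_inv_cancel h0 (ENNReal.natCast_ne_top _)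

theorem toReal_othersWeight (i j : Fin N) :
    (othersWeight i j).toReal = if j = i then 0 else (((N - 1 : ℕ) : ℝ))⁻¹ := by
  unfold othersWeight
  split_ifs
  · rfl
  · rw [ENNReal.toReal_inv, ENNReal.toReal_natCast]

theorem toReal_othersWeight_le (hN : 2 ≤ N) (i j : Fin N) :
    (othersWeight i j).toReal ≤ 2 / N := by
  have h2 : (2 : ℝ) ≤ N := by exact_mod_cast hN
  rw [toReal_othersWeight]
  split_ifs
  · positivity
  · rw [Nat.cast_sub (by omega), Nat.cast_one, inv_le_comm₀ (by linarith) (by positivity), inv_div]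
    linarith

/-- The empirical measure of the other players as a finitely supported measure. -/
def othersMeasure (hN : 2 ≤ N) (i : Fin N) {F : Type} [NormedAddCommGroup F] [MeasurableSpace F]
    [MeasurableSingletonClass F] (y : Fin N → F) : P2 F :=
  weightedP2 (sum_othersWeight hN i) y

theorem empiricalOthers_eq {d : ℕ} (hN : 2 ≤ N) (x a : Fin N → Rd d) (i : Fin N) :
    empiricalOthers hN x a i = othersMeasure hN i fun j => (x j, a j) := by
  refine Subtype.ext ?_
  simp only [empiricalOthers, othersMeasure, weightedP2, weightedDirac]
  rw [← Finset.add_sum_erase _ _ (Finset.mem_univ i), Finset.smul_sum]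
  simp only [othersWeight, if_true, zero_smul, zero_add]
  exact Finset.sum_congr rfl fun j hj => by rw [if_neg (Finset.ne_of_mem_erase hj)]

end Others

section OthersClass

variable {Q : Type} [NormedAddCommGroup Q] [NormedSpace ℝ Q] [MeasurableSpace Q]
  [MeasurableSingletonClass Q] {G V : Type} [NormedAddCommGroup G] [NormedSpace ℝ G]
  [NormedAddCommGroup V] [NormedSpace ℝ V]

/-- The functions `ω_S Ψ(A w, m^{-i}_w)` with `i ∈ S` are attached to `S`, uniformly in the number
of blocks and in the linear maps `A` of size `K` which depend on the blocks in `S` only. Here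
`Y` gives the blocks of `w`. -/
def OthersBound (k : ℕ) (K C : ℝ) (Ψ : G → P2 Q → V) : Prop :=
  ∀ {N : ℕ} (hN : 2 ≤ N) {W : Type} [NormedAddCommGroup W] [NormedSpace ℝ W]
    (E : Fin N → Q →L[ℝ] W) (Y : W →L[ℝ] (Fin N → Q)),
    (∀ j q, Y (E j q) = Pi.single j q) → ∀ (i : Fin N) (S : Finset (Fin N)) (A : W →L[ℝ] G),
    i ∈ S → (∀ j, ‖A.comp (E j)‖ ≤ K) → (∀ j ∉ S, A.comp (E j) = 0) →
    OmegaClass E k S C fun w => omegaN S • Ψ (A w) (othersMeasure hN i (Y w))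

/-- If the two first-order derivatives of `Ψ` satisfy `OthersBound`, the block derivatives of
`ω_S Ψ(A w, m^{-i}_w)` are attached to the right sets: the `j`-th atom of `m^{-i}` has mass
`1/(N-1)`, which accounts for the factor `1/N` if `j ∉ S`. -/
theorem OthersBound.omegaClass_blockDeriv [CompleteSpace V] {k l : ℕ} {K C₁ C₂ : ℝ}
    (hK : 1 ≤ K) (hC₁ : 0 ≤ C₁)
    {Ψ : G → P2 Q → V} {Dz : G → P2 Q → G →L[ℝ] V} {Dμ : G × Q → P2 Q → Q →L[ℝ] V}
    (hz : ∀ z μ, HasFDerivAt (fun z' => Ψ z' μ) (Dz z μ) z)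
    (hμ : ∀ z μ, HasWassersteinDerivAt (Ψ z) (fun y => Dμ (z, y) μ) μ)
    (hzk : IsCkBounded k l Dz) (hμk : IsCkBounded k l Dμ)
    (h₁ : OthersBound k K C₁ Dz) (h₂ : OthersBound k K C₂ Dμ)
    {N : ℕ} (hN : 2 ≤ N) {W : Type} [NormedAddCommGroup W] [NormedSpace ℝ W]
    (E : Fin N → Q →L[ℝ] W) (Y : W →L[ℝ] (Fin N → Q)) (hY : ∀ j q, Y (E j q) = Pi.single j q)
    (i : Fin N) (S : Finset (Fin N)) (A : W →L[ℝ] G) (hi : i ∈ S)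
    (hA : ∀ j, ‖A.comp (E j)‖ ≤ K) (hA0 : ∀ j ∉ S, A.comp (E j) = 0) (j : Fin N) :
    OmegaClass E k (insert j S) (K * C₁ + 2 * C₂) (blockDeriv E j
      fun w => omegaN S • Ψ (A w) (othersMeasure hN i (Y w))) := by
  have hN0 : NeZero N := ⟨by omega⟩
  have h2N : (2 : ℝ) ≤ N := by exact_mod_cast hN
  set A' : W →L[ℝ] G × Q := A.prod ((ContinuousLinearMap.proj j).comp Y) with hA'
  have hYE : ∀ m, ((ContinuousLinearMap.proj j).comp Y).comp (E m) =
      if m = j then ContinuousLinearMap.id ℝ Q else 0 := by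
    intro m
    ext q
    simp only [ContinuousLinearMap.comp_apply, hY, ContinuousLinearMap.proj_apply]
    split_ifs with h
    · subst h; simp
    · simp [Ne.symm h]
  have hA'E : ∀ m, A'.comp (E m) =
      (A.comp (E m)).prod (((ContinuousLinearMap.proj j).comp Y).comp (E m)) := fun m => rfl
  have hA'K : ∀ m, ‖A'.comp (E m)‖ ≤ K := by
    intro m
    rw [hA'E, ContinuousLinearMap.opNorm_prod, hYE]
    refine max_le (hA m) ?_
    split_ifs
    · exact (ContinuousLinearMap.norm_id_le (𝕜 := ℝ) (E := Q)).trans hK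
    · rw [norm_zero]; linarith
  have heq : blockDeriv E j (fun w => omegaN S • Ψ (A w) (othersMeasure hN i (Y w))) = fun w =>
      (omegaN S • Dz (A w) (othersMeasure hN i (Y w))).comp (A.comp (E j)) +
        (omegaN S * (othersWeight i j).toReal) • Dμ (A' w) (othersMeasure hN i (Y w)) := by
    funext w
    have h := (hasFDerivAt_weightedP2 (sum_othersWeight hN i) hz hμ hzk.jointlyContinuous
      hμk.jointlyContinuous A Y w).const_smul (omegaN S)
    rw [blockDeriv]
    erw [h.fderiv]
    ext q
    simp only [ContinuousLinearMap.comp_apply, add_apply,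
      smul_apply, sum_apply, hY, ContinuousLinearMap.proj_apply]
    rw [Finset.sum_eq_single j, Pi.single_eq_same, smul_add, mul_smul]
    · rfl
    · intro m _ hm
      rw [Pi.single_eq_of_ne hm]
      simp
    · simp
  rw [heq]
  have hω := omegaN_nonneg S
  by_cases hj : j ∈ S
  · rw [Finset.insert_eq_of_mem hj]
    refine OmegaClass.add ?_ ?_
    · exact (h₁ hN E Y hY i S A hi hA hA0).clm_comp_right (A.comp (E j)) (hA j)
    · have h3 := (h₂ hN E Y hY i S A' hi hA'K (fun m hm => by
        rw [hA'E, hA0 m hm, hYE, if_neg (ne_of_mem_of_not_mem hj hm).symm]; rfl)).clm_comp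
        ((othersWeight i j).toReal • ContinuousLinearMap.id ℝ (Q →L[ℝ] V)) (K := 2) (by
          rw [norm_smul, Real.norm_of_nonneg ENNReal.toReal_nonneg]
          have h4 : (othersWeight i j).toReal ≤ 1 :=
            (toReal_othersWeight_le hN i j).trans (by rw [div_le_one (by linarith)]; exact h2N)
          have h5 := ContinuousLinearMap.norm_id_le (𝕜 := ℝ) (E := Q →L[ℝ] V)
          have h6 : (0 : ℝ) ≤ (othersWeight i j).toReal := ENNReal.toReal_nonneg
          nlinarith [norm_nonneg (ContinuousLinearMap.id ℝ (Q →L[ℝ] V))])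
      convert h3 using 2 with w
      rw [smul_apply, ContinuousLinearMap.id_apply, smul_smul, mul_comm]
  · have h3 := (h₂ hN E Y hY i (insert j S) A' (Finset.mem_insert_of_mem hi) hA'K (fun m hm => by
        rw [Finset.mem_insert, not_or] at hm
        rw [hA'E, hA0 m hm.2, hYE, if_neg hm.1]; rfl)).clm_comp
        ((N * (othersWeight i j).toReal) • ContinuousLinearMap.id ℝ (Q →L[ℝ] V)) (K := 2) (by
          rw [norm_smul, Real.norm_of_nonneg (by positivity)]
          have h4 := toReal_othersWeight_le hN i j
          rw [le_div_iff₀ (by linarith)] at h4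
          have h5 := ContinuousLinearMap.norm_id_le (𝕜 := ℝ) (E := Q →L[ℝ] V)
          have h6 : (0 : ℝ) ≤ N * (othersWeight i j).toReal := by positivity
          nlinarith [norm_nonneg (ContinuousLinearMap.id ℝ (Q →L[ℝ] V))])
    refine OmegaClass.mono ?_ (show 2 * C₂ ≤ K * C₁ + 2 * C₂ by
      have : 0 ≤ K * C₁ := by positivity
      linarith)
    convert h3 using 2 with w
    rw [hA0 j hj, ContinuousLinearMap.comp_zero, zero_add, smul_apply,
      ContinuousLinearMap.id_apply, smul_smul, omegaN_insert_of_notMem hj]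
    congr 1
    field_simp

theorem IsCkBounded.exists_othersBound [CompleteSpace V] {k : ℕ} {Ψ : G → P2 Q → V}
    (h : IsCkBounded k 0 Ψ) {K : ℝ} (hK : 1 ≤ K) : ∃ C, 0 ≤ C ∧ OthersBound k K C Ψ := by
  induction k generalizing G V with
  | zero =>
    obtain ⟨C, hC⟩ := h.exists_bound
    refine ⟨|C|, abs_nonneg C, ?_⟩
    intro N hN W _ _ E Y hY i S A hi hA hA0 w
    rw [norm_smul, Real.norm_of_nonneg (omegaN_nonneg S), mul_comm]
    exact mul_le_mul_of_nonneg_right ((hC _ _).trans (le_abs_self C)) (omegaN_nonneg S)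
  | succ k ih =>
    obtain ⟨C, hC⟩ := h.exists_bound
    obtain ⟨_, _, Dz, Dμ, hz, hμ, hzk, hμk⟩ := h
    obtain ⟨C₁, hC₁, h₁⟩ := ih hzk
    obtain ⟨C₂, hC₂, h₂⟩ := ih hμk
    refine ⟨max |C| (K * C₁ + 2 * C₂), le_max_of_le_left (abs_nonneg C), ?_⟩
    intro N hN W _ _ E Y hY i S A hi hA hA0
    refine ⟨fun w => ?_, fun w => ?_, fun j => ?_⟩
    · rw [norm_smul, Real.norm_of_nonneg (omegaN_nonneg S), mul_comm]
      exact mul_le_mul_of_nonneg_right ((hC _ _).trans ((le_abs_self C).trans (le_max_left _ _)))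
        (omegaN_nonneg S)
    · exact ((hasFDerivAt_weightedP2 (sum_othersWeight hN i) hz hμ hzk.jointlyContinuous
        hμk.jointlyContinuous A Y w).const_smul (omegaN S)).differentiableAt
    · exact (OthersBound.omegaClass_blockDeriv hK hC₁ hz hμ hzk hμk h₁ h₂ hN E Y hY i S A hi hA hA0
        j).mono (le_max_right _ _)

/-- The block derivatives of `Ψ(w_i, m^{-i}_w)`, for `Ψ` with bounded derivatives. -/
theorem IsCkBounded.exists_omegaClass_blockDeriv [CompleteSpace V] {k : ℕ} {Ψ : Q → P2 Q → V}
    (h : IsCkBounded (k + 1) 1 Ψ) : ∃ C, 0 ≤ C ∧ ∀ {N : ℕ} (hN : 2 ≤ N) {W : Type}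
      [NormedAddCommGroup W] [NormedSpace ℝ W] (E : Fin N → Q →L[ℝ] W) (Y : W →L[ℝ] (Fin N → Q)),
      (∀ j q, Y (E j q) = Pi.single j q) → ∀ i j, OmegaClass E k {i, j} C
        (blockDeriv E j fun w => Ψ (Y w i) (othersMeasure hN i (Y w))) := by
  obtain ⟨_, _, Dz, Dμ, hz, hμ, hzk, hμk⟩ := h
  obtain ⟨C₁, hC₁, h₁⟩ := IsCkBounded.exists_othersBound hzk le_rfl
  obtain ⟨C₂, hC₂, h₂⟩ := IsCkBounded.exists_othersBound hμk le_rfl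
  refine ⟨1 * C₁ + 2 * C₂, by positivity, ?_⟩
  intro N hN W _ _ E Y hY i j
  have hYE : ∀ m, ((ContinuousLinearMap.proj i).comp Y).comp (E m) =
      if m = i then ContinuousLinearMap.id ℝ Q else 0 := by
    intro m
    ext q
    simp only [ContinuousLinearMap.comp_apply, hY, ContinuousLinearMap.proj_apply]
    split_ifs with h
    · subst h; simp
    · simp [Ne.symm h]
  have h3 := OthersBound.omegaClass_blockDeriv le_rfl hC₁ hz hμ hzk hμk h₁ h₂ hN E Y hY i {i}
    ((ContinuousLinearMap.proj i).comp Y) (Finset.mem_singleton_self i) (fun m => by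
      rw [hYE]
      split_ifs
      · exact ContinuousLinearMap.norm_id_le (𝕜 := ℝ) (E := Q)
      · rw [norm_zero]; exact zero_le_one) (fun m hm => by
      rw [hYE, if_neg (fun h => hm (by simp [h]))]) j
  rw [omegaN_singleton, Finset.pair_comm] at h3
  simpa using h3

end OthersClass

/-! ### Change of the weights of a finitely supported measure -/

section Mixture

variable {F : Type} [NormedAddCommGroup F] [MeasurableSpace F]

theorem P2.lintegral_enorm_lt_top (μ : P2 F) : ∫⁻ y, ‖y‖ₑ ∂μ.1 < ∞ := by
  have := μ.2.1
  have h : ∀ y : F, ‖y‖ₑ ≤ 1 + ‖y‖ₑ ^ 2 := fun y => by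
    rcases le_total ‖y‖ₑ 1 with h | h
    · exact h.trans le_self_add
    · refine le_trans ?_ le_add_self
      rw [pow_two]
      exact le_mul_of_one_le_left' h
  refine (lintegral_mono h).trans_lt ?_
  rw [lintegral_add_left measurable_const]
  simpa using μ.2.2

section

variable [BorelSpace F] [SecondCountableTopology F]

/-- The mixture is Lipschitz in its parameter: the mass `t - s` is moved from `μ` to `ν` along the
product coupling, while the common part stays in place. -/
theorem exists_wassersteinDist_mix_le (μ ν : P2 F) : ∃ M : ℝ≥0, ∀ s t : unitInterval, s ≤ t →
    wassersteinDist 1 (P2.mix s μ ν) (P2.mix t μ ν) ≤ ENNReal.ofReal (t - s) * M := by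
  have hμ := μ.2.1
  have hν := ν.2.1
  have hmeas : Measurable fun z : F × F => ‖z.1 - z.2‖ₑ := by fun_prop
  have hfin : ∫⁻ z, ‖z.1 - z.2‖ₑ ∂(μ.1.prod ν.1) < ∞ := by
    have h1 : ∫⁻ z, ‖z.1 - z.2‖ₑ ∂(μ.1.prod ν.1) ≤
        ∫⁻ z : F × F, (‖z.1‖ₑ + ‖z.2‖ₑ) ∂(μ.1.prod ν.1) :=
      lintegral_mono fun z => enorm_sub_le
    refine h1.trans_lt ?_
    rw [lintegral_add_left (by fun_prop)]
    have h2 := (measurePreserving_fst (μ := μ.1) (ν := ν.1)).lintegral_comp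
      (f := fun y => ‖y‖ₑ) (by fun_prop)
    have h3 := (measurePreserving_snd (μ := μ.1) (ν := ν.1)).lintegral_comp
      (f := fun y => ‖y‖ₑ) (by fun_prop)
    rw [h2, h3]
    exact ENNReal.add_lt_top.2 ⟨μ.lintegral_enorm_lt_top, ν.lintegral_enorm_lt_top⟩
  refine ⟨(∫⁻ z, ‖z.1 - z.2‖ₑ ∂(μ.1.prod ν.1)).toNNReal, fun s t hst => ?_⟩
  have hst' : (s : ℝ) ≤ t := hst
  have hdiag : Measurable fun y : F => (y, y) := by fun_prop
  have hc : IsCoupling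
      ((ENNReal.ofReal s • ν.1 + ENNReal.ofReal (1 - t) • μ.1).map (fun y => (y, y))
      + ENNReal.ofReal (t - s) • (μ.1.prod ν.1)) (P2.mix s μ ν) (P2.mix t μ ν) := by
    constructor
    · rw [Measure.map_add _ _ measurable_fst, Measure.map_map measurable_fst hdiag,
        Measure.map_smul, Measure.map_fst_prod, measure_univ, one_smul]
      change Measure.map id _ + _ = ENNReal.ofReal s • ν.1 + ENNReal.ofReal (1 - s) • μ.1
      rw [Measure.map_id, add_assoc, ← add_smul,
        ← ENNReal.ofReal_add (sub_nonneg.2 t.2.2) (sub_nonneg.2 hst')]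
      congr 3
      ring
    · rw [Measure.map_add _ _ measurable_snd, Measure.map_map measurable_snd hdiag,
        Measure.map_smul, Measure.map_snd_prod, measure_univ, one_smul]
      change Measure.map id _ + _ = ENNReal.ofReal t • ν.1 + ENNReal.ofReal (1 - t) • μ.1
      rw [Measure.map_id, add_right_comm, ← add_smul,
        ← ENNReal.ofReal_add s.2.1 (sub_nonneg.2 hst')]
      congr 3
      ring
  refine hc.wassersteinDist_le.trans ?_
  rw [eLpNorm_one_eq_lintegral_enorm, lintegral_add_measure, lintegral_map hmeas hdiag,
    lintegral_smul_measure, ENNReal.coe_toNNReal hfin.ne]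
  simp

end

variable {ι : Type} [Fintype ι] [MeasurableSingletonClass F] {p q : ι → ℝ≥0∞}

theorem sum_mix_weights (hp : ∑ j, p j = 1) (hq : ∑ j, q j = 1) (t : unitInterval) :
    ∑ j, (ENNReal.ofReal t * q j + ENNReal.ofReal (1 - t) * p j) = 1 := by
  rw [Finset.sum_add_distrib, ← Finset.mul_sum, ← Finset.mul_sum, hp, hq, mul_one, mul_one,
    ← ENNReal.ofReal_add t.2.1 (sub_nonneg.2 t.2.2)]
  simp

theorem mix_weightedP2 (hp : ∑ j, p j = 1) (hq : ∑ j, q j = 1) (t : unitInterval) (y : ι → F) :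
    P2.mix t (weightedP2 hp y) (weightedP2 hq y) = weightedP2 (sum_mix_weights hp hq t) y := by
  refine Subtype.ext ?_
  simp only [P2.mix, weightedP2, weightedDirac, add_smul, Finset.sum_add_distrib, Finset.smul_sum,
    mul_smul]

theorem wassersteinDist_mix_weightedP2_le (hp : ∑ j, p j = 1) (hq : ∑ j, q j = 1)
    (t : unitInterval) (y y' : ι → F) :
    wassersteinDist 1 (P2.mix t (weightedP2 hp y) (weightedP2 hq y))
      (P2.mix t (weightedP2 hp y') (weightedP2 hq y')) ≤
      ENNReal.ofReal (∑ j, ((p j).toReal + (q j).toReal) * ‖y j - y' j‖) := by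
  rw [mix_weightedP2, mix_weightedP2]
  refine (wassersteinDist_one_weightedP2_le _ y y').trans ?_
  rw [ENNReal.ofReal_sum_of_nonneg fun j _ => by positivity]
  refine Finset.sum_le_sum fun j _ => ?_
  rw [ENNReal.ofReal_mul (by positivity), ENNReal.ofReal_add (by positivity) (by positivity),
    ENNReal.ofReal_toReal (weight_ne_top hp j), ENNReal.ofReal_toReal (weight_ne_top hq j),
    ofReal_norm]
  refine mul_le_mul_left ?_ _
  rw [add_comm]
  refine add_le_add ?_ ?_
  · exact mul_le_of_le_one_left' (ENNReal.ofReal_le_one.2 (by linarith [t.2.1]))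
  · exact mul_le_of_le_one_left' (ENNReal.ofReal_le_one.2 t.2.2)

/-- If the linear functional derivative of `Ψ` is Lipschitz, replacing the weights `p` of a finitely
supported measure by `q` changes `Ψ` by a function of the atoms with a small Lipschitz constant. -/
theorem HasLipschitzLinearDeriv.exists_norm_sub_sub_le [BorelSpace F] [SecondCountableTopology F]
    {E V : Type} [NormedAddCommGroup E] [NormedAddCommGroup V] [NormedSpace ℝ V] [CompleteSpace V]
    {Ψ : E → P2 F → V} (h : HasLipschitzLinearDeriv Ψ) : ∃ C : ℝ, 0 ≤ C ∧
    ∀ {ι : Type} [Fintype ι] {p q : ι → ℝ≥0∞} (hp : ∑ j, p j = 1) (hq : ∑ j, q j = 1) (z z' : E)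
      (y y' : ι → F),
      ‖(Ψ z (weightedP2 hq y) - Ψ z (weightedP2 hp y)) -
        (Ψ z' (weightedP2 hq y') - Ψ z' (weightedP2 hp y'))‖ ≤
      C * ∑ j, |(q j).toReal - (p j).toReal| *
        (‖z - z'‖ + ∑ m, ((p m).toReal + (q m).toReal) * ‖y m - y' m‖ + ‖y j - y' j‖) := by
  obtain ⟨g, hg, C, hC⟩ := h
  refine ⟨C, C.2, ?_⟩
  intro ι _ p q hp hq z z' y y'
  have hnorm : ∀ (z z' : E) (μ μ' : P2 F) (y y' : F) (R : ℝ), 0 ≤ R →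
      wassersteinDist 1 μ μ' ≤ ENNReal.ofReal R →
      ‖g z μ y - g z' μ' y'‖ ≤ C * (‖z - z'‖ + R + ‖y - y'‖) := by
    intro z z' μ μ' y y' R hR hW
    have h1 : ‖g z μ y - g z' μ' y'‖ₑ ≤ C * (‖z - z'‖ₑ + ENNReal.ofReal R + ‖y - y'‖ₑ) :=
      (hC z z' μ μ' y y').trans (by gcongr)
    rw [← ofReal_norm, ← ofReal_norm, ← ofReal_norm, ← ENNReal.ofReal_add (by positivity) hR,
      ← ENNReal.ofReal_add (by positivity) (by positivity), ← ENNReal.ofReal_coe_nnreal,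
      ← ENNReal.ofReal_mul (by positivity), ENNReal.ofReal_le_ofReal_iff (by positivity)] at h1
    exact h1
  -- the integrand is continuous in `t`, so that its integral is additive
  have hcont : ∀ (z : E) (μ ν : P2 F) (y : F),
      Continuous fun t : unitInterval => g z (P2.mix t μ ν) y := by
    intro z μ ν y
    obtain ⟨M, hM⟩ := exists_wassersteinDist_mix_le μ ν
    have hle : ∀ s t : unitInterval, s ≤ t →
        ‖g z (P2.mix s μ ν) y - g z (P2.mix t μ ν) y‖ ≤ C * M * dist s t := by
      intro s t hst
      have hst' : (s : ℝ) ≤ t := hst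
      have h1 := hnorm z z (P2.mix s μ ν) (P2.mix t μ ν) y y ((t - s) * M)
        (mul_nonneg (sub_nonneg.2 hst') M.2) ((hM s t hst).trans (by
          rw [ENNReal.ofReal_mul (sub_nonneg.2 hst'), ENNReal.ofReal_coe_nnreal]))
      rw [Subtype.dist_eq, dist_comm, Real.dist_eq, abs_of_nonneg (sub_nonneg.2 hst')]
      simp only [sub_self, norm_zero, zero_add, add_zero] at h1
      exact h1.trans (le_of_eq (by ring))
    have : LipschitzWith (C * M) fun t : unitInterval => g z (P2.mix t μ ν) y := by
      refine LipschitzWith.of_dist_le_mul fun s t => ?_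
      rw [dist_eq_norm]
      rcases le_total s t with hst | hst
      · exact hle s t hst
      · rw [norm_sub_rev, dist_comm]
        exact hle t s hst
    exact this.continuous
  set f : E → (ι → F) → unitInterval → V := fun z y t =>
    ∑ j, ((q j).toReal - (p j).toReal) • g z (P2.mix t (weightedP2 hp y) (weightedP2 hq y)) (y j)
    with hf
  have hΨ : ∀ z y, Ψ z (weightedP2 hq y) - Ψ z (weightedP2 hp y) = ∫ t, f z y t := by
    intro z y
    rw [hg z (weightedP2 hp y) (weightedP2 hq y)]
    refine integral_congr_ae (Filter.Eventually.of_forall fun t => ?_)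
    change (∫ y', _ ∂weightedDirac q y) - (∫ y', _ ∂weightedDirac p y) = _
    rw [integral_weightedDirac _ _ (weight_ne_top hp),
      integral_weightedDirac _ _ (weight_ne_top hq), ← Finset.sum_sub_distrib]
    exact Finset.sum_congr rfl fun j _ => (sub_smul _ _ _).symm
  have hfc : ∀ z y, Continuous (f z y) := fun z y =>
    continuous_finsetSum _ fun j _ => (hcont z _ _ _).const_smul _
  have hfi : ∀ z y, Integrable (f z y) := fun z y =>
    (hfc z y).integrable_of_hasCompactSupport (HasCompactSupport.of_compactSpace _)
  rw [hΨ, hΨ, ← integral_sub (hfi z y) (hfi z' y')]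
  refine (norm_integral_le_of_norm_le_const (C := C * ∑ j, |(q j).toReal - (p j).toReal| *
        (‖z - z'‖ + ∑ m, ((p m).toReal + (q m).toReal) * ‖y m - y' m‖ + ‖y j - y' j‖))
    (Filter.Eventually.of_forall fun t => ?_)).trans (by simp)
  rw [hf]
  dsimp only
  rw [← Finset.sum_sub_distrib, Finset.mul_sum]
  refine (norm_sum_le _ _).trans (Finset.sum_le_sum fun j _ => ?_)
  rw [← smul_sub, norm_smul, Real.norm_eq_abs, mul_left_comm]
  refine mul_le_mul_of_nonneg_left ?_ (abs_nonneg _)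
  exact hnorm _ _ _ _ _ _ _ (by positivity) (wassersteinDist_mix_weightedP2_le hp hq t y y')

end Mixture

/-! ### Monotonicity of the system of `N` players -/

section Monotone

variable {d N : ℕ}

theorem sum_uniformWeight (hN : 2 ≤ N) : ∑ _j : Fin N, (N : ℝ≥0∞)⁻¹ = 1 := by
  have h0 : (N : ℝ≥0∞) ≠ 0 := by
    rw [Nat.cast_ne_zero]; omega
  rw [Finset.sum_const, Finset.card_univ, Fintype.card_fin, nsmul_eq_mul]
  exact ENNReal.mul_inv_cancel h0 (ENNReal.natCast_ne_top _)

/-- The monotonicity assumption for the empirical measures of all players. -/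
theorem MonotonicityAssumption.sum_inner_uniform {L : Rd d → Rd d → P2xa d → ℝ}
    (h : MonotonicityAssumption L) : ∃ c : ℝ, 0 < c ∧ ∀ {N : ℕ} (hN : 2 ≤ N) (x a b : Fin N → Rd d),
      c * ∑ i, ‖a i - b i‖ ^ 2 ≤
        ∑ i, ⟪gradA L (x i) (a i) (weightedP2 (sum_uniformWeight hN) fun j => (x j, a j)) -
          gradA L (x i) (b i) (weightedP2 (sum_uniformWeight hN) fun j => (x j, b j)),
          a i - b i⟫_ℝ := by
  obtain ⟨c, c', hc, -, H⟩ := h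
  refine ⟨c, hc, ?_⟩
  intro N hN x a b
  set P : Measure (Fin N) := weightedDirac (fun _ : Fin N => (N : ℝ≥0∞)⁻¹) id with hP
  have hPp : IsProbabilityMeasure P := ⟨by rw [hP, weightedDirac_univ, sum_uniformWeight hN]⟩
  have hmem : ∀ f : Fin N → Rd d, MemLp f 2 P := fun f => MemLp.of_discrete
  have hlaw : ∀ a : Fin N → Rd d, jointLaw P (hmem x) (hmem a) =
      weightedP2 (sum_uniformWeight hN) fun j => (x j, a j) := fun a => by
    refine Subtype.ext ?_
    change P.map (fun ω => (x ω, a ω)) =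
      weightedDirac (fun _ : Fin N => (N : ℝ≥0∞)⁻¹) fun j => (x j, a j)
    rw [hP, map_weightedDirac _ _ (Measurable.of_discrete)]
    rfl
  have h1 := H (Fin N) P x x a b (hmem x) (hmem x) (hmem a) (hmem b)
  rw [hlaw, hlaw] at h1
  have hNt : ∀ _j : Fin N, (N : ℝ≥0∞)⁻¹ ≠ ∞ := fun j =>
    weight_ne_top (p := fun _ : Fin N => (N : ℝ≥0∞)⁻¹) (sum_uniformWeight hN) j
  have hNpos : (0 : ℝ) < N := by
    have : 0 < N := by omega
    exact_mod_cast this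
  rw [hP, integral_weightedDirac _ _ hNt, integral_weightedDirac _ _ hNt,
    integral_weightedDirac _ _ hNt] at h1
  simp only [id_eq, sub_self, norm_zero, inner_zero_right, add_zero, smul_eq_mul,
    ENNReal.toReal_inv, ENNReal.toReal_natCast, ← Finset.mul_sum] at h1
  simp only [ne_eq, OfNat.ofNat_ne_zero, not_false_eq_true, zero_pow, mul_zero,
    Finset.sum_const_zero, sub_zero] at h1
  rw [mul_left_comm] at h1
  exact le_of_mul_le_mul_left h1 (inv_pos.2 hNpos)

theorem abs_othersWeight_sub_uniform_le (hN : 2 ≤ N) (i j : Fin N) :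
    |(othersWeight i j).toReal - ((N : ℝ≥0∞)⁻¹).toReal| ≤
      (if j = i then 1 / (N : ℝ) else 0) + 2 / (N : ℝ) ^ 2 := by
  have h2 : (2 : ℝ) ≤ N := by exact_mod_cast hN
  rw [toReal_othersWeight, ENNReal.toReal_inv, ENNReal.toReal_natCast]
  split_ifs
  · rw [zero_sub, abs_neg, abs_of_nonneg (by positivity), one_div]
    have : (0 : ℝ) ≤ 2 / (N : ℝ) ^ 2 := by positivity
    linarith
  · have h1 : (0 : ℝ) < (N : ℝ) - 1 := by linarith
    rw [Nat.cast_sub (by omega), Nat.cast_one, zero_add,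
      abs_of_nonneg (sub_nonneg.2 (inv_anti₀ h1 (by linarith)))]
    rw [inv_sub_inv h1.ne' (by linarith), div_le_div_iff₀ (by nlinarith) (by positivity)]
    nlinarith

/-- For many players, the `N`-player system is strongly monotone in the controls. Passing from the
empirical measure of all players to that of the others replaces the weights `1/N`, and by the
Lipschitz bound on the linear functional derivative the error is of order `1/N` in the `ℓ²`-operator
sense. -/
theorem exists_sum_inner_othersMeasure {L : Rd d → Rd d → P2xa d → ℝ}
    (hmon : MonotonicityAssumption L)
    (hlip : HasLipschitzLinearDeriv fun (z : Rd d × Rd d) μ => gradA L z.1 z.2 μ) :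
    ∃ (c : ℝ) (N₀ : ℕ), 0 < c ∧ ∀ {N : ℕ} (hN : 2 ≤ N), N₀ ≤ N → ∀ x a b : Fin N → Rd d,
      c * ∑ i, ‖a i - b i‖ ^ 2 ≤
        ∑ i, ⟪gradA L (x i) (a i) (othersMeasure hN i fun j => (x j, a j)) -
          gradA L (x i) (b i) (othersMeasure hN i fun j => (x j, b j)), a i - b i⟫_ℝ := by
  obtain ⟨c, hc, H⟩ := hmon.sum_inner_uniform
  obtain ⟨C, hC, HC⟩ := hlip.exists_norm_sub_sub_le
  -- the error terms sum up to at most `15 C / N ∑ ‖a i - b i‖²`, and `15 C / N ≤ c / 2`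
  refine ⟨c / 2, ⌈30 * C / c⌉₊, by positivity, ?_⟩
  intro N hN hN₀ x a b
  have h2 : (2 : ℝ) ≤ N := by exact_mod_cast hN
  have hNpos : (0 : ℝ) < N := by linarith
  have hN₀' : 30 * C / c ≤ N := (Nat.le_ceil _).trans (by exact_mod_cast hN₀)
  set δ : Fin N → ℝ := fun i => ‖a i - b i‖ with hδ
  have hδ0 : ∀ i, 0 ≤ δ i := fun i => norm_nonneg _
  set σ := ∑ i, δ i with hσ
  have hσ0 : 0 ≤ σ := Finset.sum_nonneg fun i _ => hδ0 i
  have hpair : ∀ j, ‖(x j, a j) - (x j, b j)‖ = δ j := fun j => by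
    simp [hδ, Prod.norm_def]
  have herr : ∀ i, ‖(gradA L (x i) (a i) (othersMeasure hN i fun j => (x j, a j)) -
        gradA L (x i) (a i) (weightedP2 (sum_uniformWeight hN) fun j => (x j, a j))) -
      (gradA L (x i) (b i) (othersMeasure hN i fun j => (x j, b j)) -
        gradA L (x i) (b i) (weightedP2 (sum_uniformWeight hN) fun j => (x j, b j)))‖ ≤
      C * (4 / N * δ i + 11 / N ^ 2 * σ) := by
    intro i
    have h1 := HC (sum_uniformWeight hN) (sum_othersWeight hN i) (x i, a i) (x i, b i)
      (fun j => (x j, a j)) (fun j => (x j, b j))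
    refine h1.trans (mul_le_mul_of_nonneg_left ?_ hC)
    simp only [hpair]
    have h3 : ∑ m, (((N : ℝ≥0∞)⁻¹).toReal + (othersWeight i m).toReal) * δ m ≤ 3 / N * σ := by
      rw [hσ, Finset.mul_sum]
      refine Finset.sum_le_sum fun m _ => mul_le_mul_of_nonneg_right ?_ (hδ0 m)
      have := toReal_othersWeight_le hN i m
      rw [ENNReal.toReal_inv, ENNReal.toReal_natCast]
      calc ((N : ℝ))⁻¹ + (othersWeight i m).toReal ≤ (N : ℝ)⁻¹ + 2 / N := by linarith
        _ = 3 / N := by field_simp; norm_num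
    calc ∑ j, |(othersWeight i j).toReal - ((N : ℝ≥0∞)⁻¹).toReal| *
          (δ i + ∑ m, (((N : ℝ≥0∞)⁻¹).toReal + (othersWeight i m).toReal) * δ m + δ j)
        ≤ ∑ j, ((if j = i then 1 / (N : ℝ) else 0) + 2 / (N : ℝ) ^ 2) *
          (δ i + 3 / N * σ + δ j) := by
          refine Finset.sum_le_sum fun j _ => ?_
          refine mul_le_mul (abs_othersWeight_sub_uniform_le hN i j) (by linarith) ?_ ?_
          · have h4 : 0 ≤ ∑ m, (((N : ℝ≥0∞)⁻¹).toReal + (othersWeight i m).toReal) * δ m :=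
              Finset.sum_nonneg fun m _ => mul_nonneg (by positivity) (hδ0 m)
            have := hδ0 i
            have := hδ0 j
            linarith
          · split_ifs <;> positivity
      _ = 1 / N * (δ i + 3 / N * σ + δ i) + 2 / (N : ℝ) ^ 2 * (N * (δ i + 3 / N * σ) + σ) := by
          simp only [add_mul, Finset.sum_add_distrib, ite_mul, zero_mul]
          rw [Finset.sum_ite_eq' Finset.univ i]
          simp only [Finset.mem_univ, if_true, ← Finset.mul_sum]
          simp only [mul_add, Finset.sum_add_distrib, Finset.sum_const, Finset.card_univ,
            Fintype.card_fin, nsmul_eq_mul, ← hσ]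
      _ = 4 / N * δ i + 11 / N ^ 2 * σ := by
          field_simp
          ring
  have hCS : σ ^ 2 ≤ N * ∑ i, δ i ^ 2 := by
    have := sq_sum_le_card_mul_sum_sq (s := Finset.univ) (f := δ)
    rwa [Finset.card_univ, Fintype.card_fin] at this
  have hsum : ∑ i, C * (4 / N * δ i + 11 / N ^ 2 * σ) * δ i ≤ c / 2 * ∑ i, δ i ^ 2 := by
    have h1 : ∑ i, C * (4 / N * δ i + 11 / N ^ 2 * σ) * δ i =
        C * (4 / N * ∑ i, δ i ^ 2 + 11 / N ^ 2 * σ ^ 2) := by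
      calc ∑ i, C * (4 / N * δ i + 11 / N ^ 2 * σ) * δ i
          = ∑ i, (C * (4 / N) * δ i ^ 2 + C * (11 / N ^ 2) * σ * δ i) :=
            Finset.sum_congr rfl fun i _ => by ring
        _ = C * (4 / N) * ∑ i, δ i ^ 2 + C * (11 / N ^ 2) * σ * σ := by
            rw [Finset.sum_add_distrib, ← Finset.mul_sum, ← Finset.mul_sum]
        _ = _ := by ring
    rw [h1]
    have hS : 0 ≤ ∑ i, δ i ^ 2 := Finset.sum_nonneg fun i _ => sq_nonneg _
    calc C * (4 / N * ∑ i, δ i ^ 2 + 11 / N ^ 2 * σ ^ 2)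
        ≤ C * (4 / N * ∑ i, δ i ^ 2 + 11 / N ^ 2 * (N * ∑ i, δ i ^ 2)) := by gcongr
      _ = 15 * C / N * ∑ i, δ i ^ 2 := by field_simp; ring
      _ ≤ c / 2 * ∑ i, δ i ^ 2 := by
          refine mul_le_mul_of_nonneg_right ?_ hS
          rw [div_le_iff₀ hc] at hN₀'
          rw [div_le_iff₀ hNpos]
          linarith
  have hfull := H hN x a b
  have hsplit : ∀ i, ⟪gradA L (x i) (a i) (weightedP2 (sum_uniformWeight hN) fun j => (x j, a j)) -
          gradA L (x i) (b i) (weightedP2 (sum_uniformWeight hN) fun j => (x j, b j)),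
          a i - b i⟫_ℝ - C * (4 / N * δ i + 11 / N ^ 2 * σ) * δ i ≤
        ⟪gradA L (x i) (a i) (othersMeasure hN i fun j => (x j, a j)) -
          gradA L (x i) (b i) (othersMeasure hN i fun j => (x j, b j)), a i - b i⟫_ℝ := by
    intro i
    have h1 := (norm_inner_le_norm (𝕜 := ℝ) _ (a i - b i)).trans
      (mul_le_mul_of_nonneg_right (herr i) (norm_nonneg (a i - b i)))
    have h4 := (abs_le.1 h1).1
    rw [sub_sub_sub_comm, inner_sub_left] at h4
    linarith
  have h5 := Finset.sum_le_sum fun i (_ : i ∈ Finset.univ) => hsplit i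
  rw [Finset.sum_sub_distrib] at h5
  linarith

end Monotone

/-! ### Legendre duality -/

section Legendre

variable {U : Type} [NormedAddCommGroup U] [InnerProductSpace ℝ U]

/-- A vector field whose derivative is uniformly positive is injective. -/
theorem injective_of_fderiv_coercive {g : U → U} (hg : Differentiable ℝ g) {c : ℝ} (hc : 0 < c)
    (h : ∀ a ξ, c * ‖ξ‖ ^ 2 ≤ ⟪ξ, fderiv ℝ g a ξ⟫_ℝ) : Function.Injective g := by
  intro a b hab
  set v := a - b with hv
  set φ : ℝ → ℝ := fun t => ⟪v, g (b + t • v)⟫_ℝ with hφ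
  have hd : ∀ t, HasDerivAt φ ⟪v, fderiv ℝ g (b + t • v) v⟫_ℝ t := by
    intro t
    have h1 : HasDerivAt (fun t : ℝ => b + t • v) v t := by
      simpa using ((hasDerivAt_id t).smul_const v).const_add b
    have h2 := (hg (b + t • v)).hasFDerivAt.comp_hasDerivAt t h1
    exact (innerSL ℝ v).hasFDerivAt.comp_hasDerivAt t h2
  have h01 : φ 0 = φ 1 := by simp [hφ, hv, hab]
  obtain ⟨t, -, ht⟩ := exists_hasDerivAt_eq_zero zero_lt_one
    (fun t _ => (hd t).continuousAt.continuousWithinAt) h01 fun t _ => hd t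
  have h1 := h (b + t • v) v
  rw [ht] at h1
  have h2 : ‖v‖ ^ 2 ≤ 0 := nonpos_of_mul_nonpos_right h1 hc
  have h3 : ‖v‖ = 0 := by nlinarith [norm_nonneg v]
  exact sub_eq_zero.1 (norm_eq_zero.1 h3)

/-- For a function `f` that grows at least quadratically and has an injective gradient, the gradient
of `p ↦ sup_a (-a · p - f a)` and that of `f` are inverse to each other, up to signs. -/
theorem eq_neg_gradient_conjugate_iff [FiniteDimensional ℝ U] [CompleteSpace U] {f : U → ℝ}
    {g : U → U} (hf : ∀ a, HasGradientAt f (g a) a) (hg : Function.Injective g) {C : ℝ} (hC : 0 < C)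
    (hfC : ∀ a, 1 / C * ‖a‖ ^ 2 - C ≤ f a) {p : U}
    (hH : DifferentiableAt ℝ (fun p => ⨆ a, (-⟪a, p⟫_ℝ - f a)) p) (a : U) :
    a = -gradient (fun p => ⨆ a, (-⟪a, p⟫_ℝ - f a)) p ↔ g a = -p := by
  set H : U → ℝ := fun p => ⨆ a, (-⟪a, p⟫_ℝ - f a) with hHdef
  have hfc : Continuous f :=
    continuous_iff_continuousAt.2 fun a => (hf a).hasFDerivAt.continuousAt
  have hbdd : ∀ p, BddAbove (Set.range fun a => -⟪a, p⟫_ℝ - f a) := by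
    intro p
    refine ⟨C + C * ‖p‖ ^ 2, ?_⟩
    rintro _ ⟨a, rfl⟩
    have h1 := abs_le.1 (abs_real_inner_le_norm a p)
    have h2 := hfC a
    have h3 : ‖a‖ * ‖p‖ ≤ 1 / C * ‖a‖ ^ 2 + C * ‖p‖ ^ 2 := by
      have h4 : 0 ≤ 1 / C * (‖a‖ - C * ‖p‖) ^ 2 := by positivity
      have h5 : 1 / C * (‖a‖ - C * ‖p‖) ^ 2 =
          1 / C * ‖a‖ ^ 2 - 2 * (‖a‖ * ‖p‖) + C * ‖p‖ ^ 2 := by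
        field_simp
        ring
      have : 0 ≤ ‖a‖ * ‖p‖ := by positivity
      linarith
    dsimp only
    linarith [h1.1]
  -- the supremum is attained
  obtain ⟨a₀, ha₀⟩ : ∃ a₀, ∀ a, ⟪a₀, p⟫_ℝ + f a₀ ≤ ⟪a, p⟫_ℝ + f a := by
    refine Continuous.exists_forall_le (by fun_prop) ?_
    have h1 : Filter.Tendsto (fun a : U => ‖a‖ * (1 / C * ‖a‖ - ‖p‖) - C) (Filter.cocompact U)
        Filter.atTop := by
      have hn := tendsto_norm_cocompact_atTop (E := U)
      refine Filter.tendsto_atTop_add_const_right _ _ (hn.atTop_mul_atTop₀ ?_)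
      exact Filter.tendsto_atTop_add_const_right _ _ (hn.const_mul_atTop (by positivity))
    refine Filter.tendsto_atTop_mono (fun a => ?_) h1
    have h2 := (abs_le.1 (abs_real_inner_le_norm a p)).1
    have h3 := hfC a
    nlinarith
  have hga₀ : g a₀ = -p := by
    have hmin : IsLocalMin (fun a => ⟪a, p⟫_ℝ + f a) a₀ := Filter.Eventually.of_forall ha₀
    have hd : HasFDerivAt (fun a => ⟪a, p⟫_ℝ + f a)
        (innerSL ℝ p + InnerProductSpace.toDual ℝ U (g a₀)) a₀ := by
      refine HasFDerivAt.add ?_ (hf a₀).hasFDerivAt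
      simp_rw [real_inner_comm]
      exact (innerSL ℝ p).hasFDerivAt
    have h0 := hmin.hasFDerivAt_eq_zero hd
    have h1 : ∀ v, ⟪p + g a₀, v⟫_ℝ = 0 := fun v => by
      have := DFunLike.congr_fun h0 v
      simpa [inner_add_left] using this
    have h2 := inner_self_eq_zero.1 (h1 (p + g a₀))
    exact eq_neg_of_add_eq_zero_right h2
  -- `H` has the tangent `-⟪a₀, ·⟫ - f a₀` at `p`
  have hgH : gradient H p = -a₀ := by
    have hHp : H p = -⟪a₀, p⟫_ℝ - f a₀ := by
      refine le_antisymm (ciSup_le fun a => ?_) (le_ciSup (hbdd p) a₀)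
      have := ha₀ a
      linarith
    have hmin : IsLocalMin (fun q => H q + ⟪a₀, q⟫_ℝ) p := by
      refine Filter.Eventually.of_forall fun q => ?_
      have h1 : -⟪a₀, q⟫_ℝ - f a₀ ≤ H q := le_ciSup (hbdd q) a₀
      dsimp only
      rw [hHp]
      linarith
    have hd : HasFDerivAt (fun q => H q + ⟪a₀, q⟫_ℝ)
        (InnerProductSpace.toDual ℝ U (gradient H p) + innerSL ℝ a₀) p :=
      (hH.hasGradientAt.hasFDerivAt).add (innerSL ℝ a₀).hasFDerivAt
    have h0 := hmin.hasFDerivAt_eq_zero hd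
    have h1 : ∀ v, ⟪gradient H p + a₀, v⟫_ℝ = 0 := fun v => by
      have := DFunLike.congr_fun h0 v
      simpa [inner_add_left] using this
    exact eq_neg_of_add_eq_zero_left (inner_self_eq_zero.1 (h1 (gradient H p + a₀)))
  rw [hgH, neg_neg]
  constructor
  · rintro rfl
    exact hga₀
  · intro h
    exact hg (h.trans hga₀.symm)

end Legendre

section GameLegendre

variable {d : ℕ}

theorem hasFDerivAt_and_toDual_gradA {L : Rd d → Rd d → P2xa d → ℝ}
    {Dz : Rd d × Rd d → P2xa d → Rd d × Rd d →L[ℝ] ℝ}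
    (hz : ∀ z μ, HasFDerivAt (fun z' : Rd d × Rd d => L z'.1 z'.2 μ) (Dz z μ) z) (x a : Rd d)
    (μ : P2xa d) :
    HasFDerivAt (fun a' => L x a' μ)
      ((Dz (x, a) μ).comp (ContinuousLinearMap.inr ℝ (Rd d) (Rd d))) a ∧
    InnerProductSpace.toDual ℝ (Rd d) (gradA L x a μ) =
      (Dz (x, a) μ).comp (ContinuousLinearMap.inr ℝ (Rd d) (Rd d)) := by
  have h : HasFDerivAt (fun a' => L x a' μ)
      ((Dz (x, a) μ).comp (ContinuousLinearMap.inr ℝ (Rd d) (Rd d))) a :=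
    (hz (x, a) μ).comp a (hasFDerivAt_prodMk_right x a)
  refine ⟨h, ?_⟩
  rw [gradA, h.hasGradientAt.gradient, LinearIsometryEquiv.apply_symm_apply]

/-- The fixed-point equation in terms of the Lagrangian. -/
theorem RegularityAssumption.eq_neg_gradA_hamiltonian_iff {L : Rd d → Rd d → P2xa d → ℝ}
    (h : RegularityAssumption L) (x p a : Rd d) (μ : P2xa d) :
    a = -gradA (hamiltonian L) x p μ ↔ gradA L x a μ = -p := by
  obtain ⟨-, -, Dz, -, hz, -, ⟨-, -, Dzz, -, hzz, -, -⟩, -⟩ := h.smooth_L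
  obtain ⟨-, -, DzH, -, hzH, -, -⟩ := h.smooth_H
  obtain ⟨c, hc, hconv⟩ := h.strictly_convex
  obtain ⟨C, hC, hco⟩ := h.coercive
  have hgrad : ∀ a, HasGradientAt (fun a' => L x a' μ) (gradA L x a μ) a := fun a => by
    rw [hasGradientAt_iff_hasFDerivAt, (hasFDerivAt_and_toDual_gradA hz x a μ).2]
    exact (hasFDerivAt_and_toDual_gradA hz x a μ).1
  have hdiff : Differentiable ℝ fun a => gradA L x a μ := by
    have heq : (fun a => gradA L x a μ) = fun a => (InnerProductSpace.toDual ℝ (Rd d)).symm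
        ((Dz (x, a) μ).comp (ContinuousLinearMap.inr ℝ (Rd d) (Rd d))) := by
      funext a
      rw [← (hasFDerivAt_and_toDual_gradA hz x a μ).2, LinearIsometryEquiv.symm_apply_apply]
    rw [heq]
    refine (InnerProductSpace.toDual ℝ (Rd d)).symm.toContinuousLinearEquiv.differentiable.comp ?_
    refine Differentiable.clm_comp (fun a => ?_) (differentiable_const _)
    exact ((hzz (x, a) μ).comp a (hasFDerivAt_prodMk_right x a)).differentiableAt
  refine eq_neg_gradient_conjugate_iff hgrad
    (injective_of_fderiv_coercive hdiff hc fun a ξ => hconv x a μ ξ) hC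
    (fun a => (hco x a μ).1) ?_ a
  exact ((hzH (x, p) μ).comp p (hasFDerivAt_prodMk_right x p)).differentiableAt

end GameLegendre

/-! ### Solvability of strongly monotone systems -/

section MonotoneSystem

theorem ContDiff.isOpenMap_of_injective_fderiv {U : Type} [NormedAddCommGroup U] [NormedSpace ℝ U]
    [FiniteDimensional ℝ U] {f : U → U} (hf : ContDiff ℝ 1 f)
    (h : ∀ u, Function.Injective (fderiv ℝ f u)) : IsOpenMap f := by
  have := FiniteDimensional.complete ℝ U
  refine isOpenMap_of_hasStrictFDerivAt_equiv
    (f' := fun u => (LinearEquiv.ofInjectiveEndo (fderiv ℝ f u : U →ₗ[ℝ] U)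
      (h u)).toContinuousLinearEquiv) fun u => ?_
  exact hf.contDiffAt.hasStrictFDerivAt one_ne_zero

/-- An expanding map with invertible derivatives is onto, as its range is open and closed. -/
theorem ContDiff.surjective_of_antilipschitz {U : Type} [NormedAddCommGroup U] [NormedSpace ℝ U]
    [FiniteDimensional ℝ U] {f : U → U} (hf : ContDiff ℝ 1 f)
    (h : ∀ u, Function.Injective (fderiv ℝ f u)) {K : ℝ≥0} (hK : AntilipschitzWith K f) :
    Function.Surjective f := by
  have := FiniteDimensional.proper ℝ U
  have hcl : IsClosedMap f := by
    refine IsProperMap.isClosedMap ?_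
    rw [isProperMap_iff_tendsto_cocompact]
    refine ⟨hf.continuous, ?_⟩
    rw [← Metric.cobounded_eq_cocompact]
    exact hK.tendsto_cobounded
  have hop := hf.isOpenMap_of_injective_fderiv h
  exact Set.range_eq_univ.1
    (IsClopen.eq_univ ⟨hcl.isClosed_range, hop.isOpen_range⟩ ⟨f 0, 0, rfl⟩)

variable {H : Type} [NormedAddCommGroup H] [InnerProductSpace ℝ H]
  {N : ℕ} {G : Fin N → (Fin N → H) × (Fin N → H) → H →L[ℝ] ℝ} {c : ℝ}

/-- The infinitesimal version of strong monotonicity. -/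
theorem le_sum_fderiv_of_monotone (hG : ∀ i, Differentiable ℝ (G i))
    (hmon : ∀ x a b : Fin N → H, c * ∑ i, ‖a i - b i‖ ^ 2 ≤
      ∑ i, (G i (x, a) - G i (x, b)) (a i - b i))
    (w : (Fin N → H) × (Fin N → H)) (ξ : Fin N → H) :
    c * ∑ i, ‖ξ i‖ ^ 2 ≤ ∑ i, fderiv ℝ (G i) w (0, ξ) (ξ i) := by
  -- `h` is monotone, and the claim is `h' 0 ≥ 0`
  set h : ℝ → ℝ := fun t => ∑ i, G i (w.1, w.2 + t • ξ) (ξ i) - t * (c * ∑ i, ‖ξ i‖ ^ 2) with hh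
  have hd : HasDerivAt h (∑ i, fderiv ℝ (G i) w (0, ξ) (ξ i) - 1 * (c * ∑ i, ‖ξ i‖ ^ 2)) 0 := by
    refine HasDerivAt.sub (HasDerivAt.fun_sum fun i _ => ?_) ((hasDerivAt_id 0).mul_const _)
    have h1 : HasDerivAt (fun t : ℝ => (w.1, w.2 + t • ξ)) (0, ξ) 0 := by
      refine (hasDerivAt_const _ _).prodMk ?_
      simpa using ((hasDerivAt_id (0 : ℝ)).smul_const ξ).const_add w.2
    have h2 : HasFDerivAt (G i) (fderiv ℝ (G i) w) (w.1, w.2 + (0 : ℝ) • ξ) := by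
      simpa using (hG i w).hasFDerivAt
    exact (ContinuousLinearMap.apply ℝ ℝ (ξ i)).hasFDerivAt.comp_hasDerivAt 0
      (h2.comp_hasDerivAt 0 h1)
  have hm : Monotone h := by
    intro s t hst
    rcases hst.eq_or_lt with rfl | hst
    · exact le_rfl
    have h1 := hmon w.1 (w.2 + t • ξ) (w.2 + s • ξ)
    have h2 : ∀ i, (w.2 + t • ξ) i - (w.2 + s • ξ) i = (t - s) • ξ i := fun i => by
      simp only [Pi.add_apply, Pi.smul_apply, add_sub_add_left_eq_sub, sub_smul]
    simp only [h2, norm_smul, map_smul, smul_eq_mul, mul_pow, ← Finset.mul_sum,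
      Real.norm_eq_abs, sq_abs] at h1
    have h3 : (t - s) * (c * ∑ i, ‖ξ i‖ ^ 2) ≤
        ∑ i, (G i (w.1, w.2 + t • ξ) - G i (w.1, w.2 + s • ξ)) (ξ i) :=
      le_of_mul_le_mul_left (by linarith) (sub_pos.2 hst)
    simp only [sub_apply, Finset.sum_sub_distrib] at h3
    simp only [hh]
    linarith
  have h1 := hm.deriv_nonneg (x := 0)
  rw [hd.deriv] at h1
  linarith

/-- A strongly monotone system `G_i(x, a) = -p_i` has a unique solution, which is as smooth as
the system. -/
theorem exists_contDiff_solution [FiniteDimensional ℝ H] {n : WithTop ℕ∞} (hn : 1 ≤ n)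
    (hG : ∀ i, ContDiff ℝ n (G i))
    (hc : 0 < c) (hmon : ∀ x a b : Fin N → H, c * ∑ i, ‖a i - b i‖ ^ 2 ≤
      ∑ i, (G i (x, a) - G i (x, b)) (a i - b i)) :
    ∃ a : (Fin N → H) × (Fin N → H) → (Fin N → H), ContDiff ℝ n a ∧ ∀ x p b : Fin N → H,
      (∀ i, G i (x, b) = -innerSL ℝ (p i)) ↔ b = a (x, p) := by
  have hGd : ∀ i, Differentiable ℝ (G i) := fun i =>
    (hG i).differentiable (by rintro rfl; simp at hn)
  have hco := le_sum_fderiv_of_monotone hGd hmon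
  set J : (H →L[ℝ] ℝ) ≃L[ℝ] H := (InnerProductSpace.toDual ℝ H).symm.toContinuousLinearEquiv with hJ
  set g : (Fin N → H) × (Fin N → H) → (Fin N → H) := fun w i => J (G i w) with hg
  have hgn : ContDiff ℝ n g := contDiff_pi.2 fun i => J.contDiff.comp (hG i)
  have hgd : Differentiable ℝ g := hgn.differentiable (by rintro rfl; simp at hn)
  have hg' : ∀ w v i, fderiv ℝ g w v i = J (fderiv ℝ (G i) w v) := by
    intro w v i
    have h1 : HasFDerivAt g (ContinuousLinearMap.pi fun i =>
        (J : (H →L[ℝ] ℝ) →L[ℝ] H).comp (fderiv ℝ (G i) w)) w :=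
      hasFDerivAt_pi.2 fun i => J.hasFDerivAt.comp w (hGd i w).hasFDerivAt
    rw [h1.fderiv]
    rfl
  have hker : ∀ w ξ, fderiv ℝ g w (0, ξ) = 0 → ξ = 0 := by
    intro w ξ h0
    have h1 := hco w ξ
    have h2 : ∀ i, fderiv ℝ (G i) w (0, ξ) = 0 := fun i => by
      have := congrFun h0 i
      rw [hg'] at this
      simpa using this
    simp only [h2, zero_apply, Finset.sum_const_zero] at h1
    have h3 : ∑ i, ‖ξ i‖ ^ 2 ≤ 0 := nonpos_of_mul_nonpos_right h1 hc
    have h4 := (Finset.sum_eq_zero_iff_of_nonneg fun i _ => sq_nonneg _).1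
      (le_antisymm h3 (Finset.sum_nonneg fun i _ => sq_nonneg ‖ξ i‖))
    funext i
    simpa using h4 i (Finset.mem_univ i)
  have hanti : ∀ x a b : Fin N → H, ‖a - b‖ ≤ N / c * ‖g (x, a) - g (x, b)‖ := by
    intro x a b
    set R : ℝ := N * ‖g (x, a) - g (x, b)‖ * ‖a - b‖ / c with hR
    have hR0 : 0 ≤ R := by positivity
    have h1 : ∀ i, ‖(a - b) i‖ ≤ Real.sqrt R := by
      intro i
      refine Real.le_sqrt_of_sq_le ?_
      rw [hR, le_div_iff₀ hc, mul_comm]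
      calc c * ‖(a - b) i‖ ^ 2 ≤ c * ∑ i, ‖a i - b i‖ ^ 2 := by
            refine mul_le_mul_of_nonneg_left ?_ hc.le
            exact Finset.single_le_sum (f := fun i => ‖a i - b i‖ ^ 2) (fun i _ => sq_nonneg _)
              (Finset.mem_univ i)
        _ ≤ ∑ i, (G i (x, a) - G i (x, b)) (a i - b i) := hmon x a b
        _ ≤ ∑ _i : Fin N, ‖g (x, a) - g (x, b)‖ * ‖a - b‖ := by
            refine Finset.sum_le_sum fun i _ => ?_
            refine (Real.le_norm_self _).trans ?_
            refine ContinuousLinearMap.le_of_opNorm_le_of_le _ ?_ (norm_le_pi_norm (a - b) i)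
            have h2 := norm_le_pi_norm (g (x, a) - g (x, b)) i
            rw [Pi.sub_apply, hg] at h2
            dsimp only at h2
            rw [← map_sub] at h2
            exact ((InnerProductSpace.toDual ℝ H).symm.norm_map _).symm.le.trans h2
        _ = N * ‖g (x, a) - g (x, b)‖ * ‖a - b‖ := by
            rw [Finset.sum_const, Finset.card_univ, Fintype.card_fin, nsmul_eq_mul]; ring
    have h2 : ‖a - b‖ ^ 2 ≤ R := by
      have h3 := (pi_norm_le_iff_of_nonneg (Real.sqrt_nonneg R)).2 h1
      have h4 := pow_le_pow_left₀ (norm_nonneg _) h3 2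
      rwa [Real.sq_sqrt hR0] at h4
    rcases (norm_nonneg (a - b)).eq_or_lt with h0 | h0
    · rw [← h0]; positivity
    · refine le_of_mul_le_mul_right ?_ h0
      calc ‖a - b‖ * ‖a - b‖ = ‖a - b‖ ^ 2 := by ring
        _ ≤ R := h2
        _ = _ := by rw [hR]; ring
  have hsurj : ∀ x, Function.Surjective fun a => g (x, a) := by
    intro x
    have hx : ContDiff ℝ n fun a => g (x, a) := hgn.comp (contDiff_const.prodMk contDiff_id)
    have hxd : ∀ a ξ, fderiv ℝ (fun a => g (x, a)) a ξ = fderiv ℝ g (x, a) (0, ξ) := by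
      intro a ξ
      have h1 := ((hgd (x, a)).hasFDerivAt.comp a (hasFDerivAt_prodMk_right x a)).fderiv
      exact DFunLike.congr_fun h1 ξ
    refine (hx.of_le hn).surjective_of_antilipschitz (fun a => ?_)
      (K := ⟨N / c, by positivity⟩) ?_
    · refine (injective_iff_map_eq_zero _).2 fun ξ hξ => ?_
      rw [hxd] at hξ
      exact hker _ _ hξ
    · refine AntilipschitzWith.of_le_mul_dist fun a b => ?_
      rw [dist_eq_norm, dist_eq_norm]
      exact hanti x a b
  -- the smoothness of the solution follows from that of the inverse of `(x, a) ↦ (x, g (x, a))`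
  set T : (Fin N → H) × (Fin N → H) → (Fin N → H) × (Fin N → H) := fun w => (w.1, g w) with hT
  have hTn : ContDiff ℝ n T := contDiff_fst.prodMk hgn
  have hT' : ∀ w, HasFDerivAt T ((ContinuousLinearMap.fst ℝ _ _).prod (fderiv ℝ g w)) w := fun w =>
    hasFDerivAt_fst.prodMk (hgd w).hasFDerivAt
  have hTinj : ∀ w, Function.Injective (fderiv ℝ T w) := by
    intro w
    refine (injective_iff_map_eq_zero _).2 fun v hv => ?_
    rw [(hT' w).fderiv] at hv
    obtain ⟨u, ξ⟩ := v
    obtain ⟨h1, h2⟩ := Prod.mk.inj hv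
    have h1 : u = 0 := h1
    subst h1
    rw [hker w ξ h2]
    rfl
  have hbij : Function.Bijective T := by
    constructor
    · rintro ⟨x, a⟩ ⟨x', b⟩ h
      obtain ⟨h1, h2⟩ := Prod.mk.inj h
      dsimp only at h1
      subst h1
      have h3 := hanti x a b
      rw [h2, sub_self, norm_zero, mul_zero] at h3
      rw [sub_eq_zero.1 (norm_le_zero_iff.1 h3)]
    · rintro ⟨x, y⟩
      obtain ⟨a, ha⟩ := hsurj x y
      exact ⟨(x, a), Prod.ext rfl ha⟩
  set e : (Fin N → H) × (Fin N → H) ≃ₜ (Fin N → H) × (Fin N → H) :=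
    (Equiv.ofBijective T hbij).toHomeomorphOfContinuousOpen hTn.continuous
      ((hTn.of_le hn).isOpenMap_of_injective_fderiv hTinj) with he
  have hsymm : ContDiff ℝ n e.symm := by
    refine Homeomorph.contDiff_symm e (f₀' := fun w =>
      (LinearEquiv.ofInjectiveEndo (fderiv ℝ T w : _ →ₗ[ℝ] _)
        (hTinj w)).toContinuousLinearEquiv) (fun w => ?_) hTn
    exact (hT' w).differentiableAt.hasFDerivAt
  refine ⟨fun w => (e.symm (w.1, -w.2)).2,
    contDiff_snd.comp (hsymm.comp (contDiff_fst.prodMk contDiff_snd.neg)), fun x p b => ?_⟩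
  have h1 : (∀ i, G i (x, b) = -innerSL ℝ (p i)) ↔ T (x, b) = (x, -p) := by
    rw [Prod.ext_iff]
    simp only [hT, true_and]
    rw [funext_iff]
    refine forall_congr' fun i => ?_
    have h2 : G i (x, b) = InnerProductSpace.toDual ℝ H (J (G i (x, b))) :=
      ((InnerProductSpace.toDual ℝ H).apply_symm_apply _).symm
    have h3 : -innerSL ℝ (p i) = InnerProductSpace.toDual ℝ H ((-p) i) := by
      rw [Pi.neg_apply, map_neg]; rfl
    rw [h3]
    conv_lhs => rw [h2]
    exact (InnerProductSpace.toDual ℝ H).injective.eq_iff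
  rw [h1]
  constructor
  · intro h
    have h2 : e.symm (x, -p) = (x, b) := by
      rw [Homeomorph.symm_apply_eq]
      exact h.symm
    dsimp only
    rw [h2]
  · intro h
    have h2 : T (e.symm (x, -p)) = (x, -p) := e.apply_symm_apply (x, -p)
    have h3 : (e.symm (x, -p)).1 = x := (Prod.ext_iff.1 h2).1
    have h4 : e.symm (x, -p) = (x, b) := Prod.ext h3 h.symm
    rw [h4] at h2
    exact h2

end MonotoneSystem

/-! ### Decay of the derivatives of the solution map -/

section SolutionMap

variable {H : Type} [NormedAddCommGroup H] [NormedSpace ℝ H] {N : ℕ}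

/-- The inclusion of the `j`-th block of variables `(x^j, a^j)`. -/
def blockIncl (H : Type) [NormedAddCommGroup H] [NormedSpace ℝ H] {N : ℕ} (j : Fin N) :
    H × H →L[ℝ] (Fin N → H) × (Fin N → H) :=
  (ContinuousLinearMap.single ℝ (fun _ => H) j).prodMap
    (ContinuousLinearMap.single ℝ (fun _ => H) j)

theorem blockIncl_apply (j : Fin N) (q : H × H) :
    blockIncl H j q = (Pi.single j q.1, Pi.single j q.2) := rfl

/-- The blocks `(x^j, a^j)` of `(x, a)`. -/
def blocks (H : Type) [NormedAddCommGroup H] [NormedSpace ℝ H] (N : ℕ) :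
    (Fin N → H) × (Fin N → H) →L[ℝ] (Fin N → H × H) :=
  ContinuousLinearMap.pi fun j =>
    (ContinuousLinearMap.proj j).prodMap (ContinuousLinearMap.proj j)

theorem blocks_apply (w : (Fin N → H) × (Fin N → H)) (j : Fin N) :
    blocks H N w j = (w.1 j, w.2 j) := rfl

theorem blocks_blockIncl (j : Fin N) (q : H × H) :
    blocks H N (blockIncl H j q) = Pi.single j q := by
  funext m
  rw [blocks_apply, blockIncl_apply]
  by_cases h : m = j
  · subst h; simp
  · simp [h]

theorem sum_blockIncl_blocks (w : (Fin N → H) × (Fin N → H)) :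
    ∑ m, blockIncl H m (w.1 m, w.2 m) = w := by
  simp only [blockIncl_apply]
  refine Prod.ext ?_ ?_
  · rw [Prod.fst_sum]; exact Finset.univ_sum_single w.1
  · rw [Prod.snd_sum]; exact Finset.univ_sum_single w.2

section Graph

variable {a : (Fin N → H) × (Fin N → H) → (Fin N → H)}

theorem hasFDerivAt_block_graph (ha : Differentiable ℝ a) (m : Fin N)
    (w : (Fin N → H) × (Fin N → H)) :
    HasFDerivAt (fun w => (w.1 m, a w m)) (((ContinuousLinearMap.proj m).comp
      (ContinuousLinearMap.fst ℝ (Fin N → H) (Fin N → H))).prod (fderiv ℝ (fun w => a w m) w)) w :=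
  (((ContinuousLinearMap.proj m).comp
    (ContinuousLinearMap.fst ℝ (Fin N → H) (Fin N → H))).hasFDerivAt).prodMk
      (differentiable_pi.1 ha m w).hasFDerivAt

theorem blockDeriv_block_graph (ha : Differentiable ℝ a) (m j : Fin N)
    (w : (Fin N → H) × (Fin N → H)) :
    blockDeriv (blockIncl H) j (fun w => (w.1 m, a w m)) w =
      (ContinuousLinearMap.inl ℝ H H).comp
        (if m = j then ContinuousLinearMap.fst ℝ H H else 0) +
      (ContinuousLinearMap.inr ℝ H H).comp
        (blockDeriv (blockIncl H) j (fun w => a w m) w) := by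
  simp only [blockDeriv]
  rw [(hasFDerivAt_block_graph ha m w).fderiv]
  refine ContinuousLinearMap.ext fun q => ?_
  by_cases h : m = j
  · subst h; simp [blockIncl_apply]
  · simp [blockIncl_apply, h]

/-- The chain rule for the graph map `w ↦ (x, a(w))`, block by block. -/
theorem fderiv_graph_comp_blockIncl (ha : Differentiable ℝ a) (j : Fin N)
    (w : (Fin N → H) × (Fin N → H)) :
    (fderiv ℝ (fun w => (w.1, a w)) w).comp (blockIncl H j) =
      ∑ m, (blockIncl H m).comp (blockDeriv (blockIncl H) j (fun w => (w.1 m, a w m)) w) := by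
  have h2 : HasFDerivAt (fun w => ∑ m, blockIncl H m (w.1 m, a w m))
      (∑ m, (blockIncl H m).comp (fderiv ℝ (fun w => (w.1 m, a w m)) w)) w :=
    HasFDerivAt.fun_sum fun m _ => (blockIncl H m).hasFDerivAt.comp w
      (hasFDerivAt_block_graph ha m w).differentiableAt.hasFDerivAt
  have h3 : (fun w => ∑ m, blockIncl H m (w.1 m, a w m)) = fun w => (w.1, a w) := by
    funext w
    exact sum_blockIncl_blocks (w.1, a w)
  rw [h3] at h2
  rw [h2.fderiv]
  refine ContinuousLinearMap.ext fun q => ?_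
  simp only [ContinuousLinearMap.comp_apply, sum_apply, blockDeriv]

theorem OmegaClass.blockDeriv_block_graph (ha : Differentiable ℝ a) {k : ℕ} {C : ℝ} {m j : Fin N}
    (h : OmegaClass (blockIncl H) k {m, j} C (blockDeriv (blockIncl H) j fun w => a w m)) :
    OmegaClass (blockIncl H) k {m, j} (1 + C)
      (blockDeriv (blockIncl H) j fun w => (w.1 m, a w m)) := by
  have h1 : blockDeriv (blockIncl H) j (fun w => (w.1 m, a w m)) = fun w =>
      (ContinuousLinearMap.inl ℝ H H).comp (if m = j then ContinuousLinearMap.fst ℝ H H else 0) +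
      (ContinuousLinearMap.inr ℝ H H).comp (blockDeriv (blockIncl H) j (fun w => a w m) w) :=
    funext fun w => _root_.blockDeriv_block_graph ha m j w
  rw [h1]
  refine OmegaClass.add (omegaClass_const k _ zero_le_one ?_) ?_
  · split_ifs with h
    · subst h
      rw [Finset.pair_eq_singleton, omegaN_singleton, mul_one]
      refine (ContinuousLinearMap.opNorm_comp_le _ _).trans ?_
      exact mul_le_one₀ (ContinuousLinearMap.norm_inl_le_one ℝ H H) (norm_nonneg _)
        (ContinuousLinearMap.norm_fst_le ℝ H H)
    · rw [ContinuousLinearMap.comp_zero, norm_zero, one_mul]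
      exact omegaN_nonneg _
  · have h2 := h.clm_comp_left (ContinuousLinearMap.inr ℝ H H)
      (ContinuousLinearMap.norm_inr_le_one ℝ H H)
    rwa [one_mul] at h2

end Graph

/-- One step of the bootstrap: the derivatives of order `k + 1` of a map `a` defined by
`G_i(x, a(x, p)) = -J p_i` are bounded in terms of those of lower order (a condition that is void
for `k = 0`). Differentiating the equation gives a linear system for `D_j a`. -/
theorem exists_omegaClass_solutionMap_step (k : ℕ) (H Z : Type) [NormedAddCommGroup H]
    [NormedSpace ℝ H] [NormedAddCommGroup Z] [NormedSpace ℝ Z] (K C₁ C' : ℝ) (hK : 0 ≤ K)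
    (hC₁ : 0 ≤ C₁) (hC' : 0 ≤ C') :
    ∃ C : ℝ, 0 ≤ C ∧ ∀ {N : ℕ} [NeZero N]
      (J : H →L[ℝ] Z) (G : Fin N → (Fin N → H) × (Fin N → H) → Z)
      (a : (Fin N → H) × (Fin N → H) → (Fin N → H)),
      ‖J‖ ≤ 1 → (∀ i, Differentiable ℝ (G i)) →
      (∀ i m, OmegaClass (blockIncl H) k {i, m} C₁ (blockDeriv (blockIncl H) m (G i))) →
      (∀ w, OmegaSolvable (k + 1) K (fun i m => (blockDeriv (blockIncl H) m (G i) w).comp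
        (ContinuousLinearMap.inr ℝ H H)) (ContinuousLinearMap.id ℝ (H →L[ℝ] Z))) →
      ContDiff ℝ (k + 1 : ℕ) a → (∀ w i, G i (w.1, a w) = -J (w.2 i)) →
      (∀ l, k = l + 1 → ∀ j m, OmegaClass (blockIncl H) l {m, j} C'
        (blockDeriv (blockIncl H) j fun w => a w m)) →
      ∀ j m, OmegaClass (blockIncl H) k {m, j} C (blockDeriv (blockIncl H) j fun w => a w m) := by
  -- the composed coefficients `(D_m G_i)(x, a(x, p))`
  obtain ⟨C₂, hC₂, hcomp⟩ : ∃ C₂ : ℝ, 0 ≤ C₂ ∧ ∀ {N : ℕ} [NeZero N] (S : Finset (Fin N))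
      (f : (Fin N → H) × (Fin N → H) → H × H →L[ℝ] Z)
      (φ : (Fin N → H) × (Fin N → H) → (Fin N → H) × (Fin N → H))
      (y : Fin N → (Fin N → H) × (Fin N → H) → H × H),
      S.card ≤ 2 → Differentiable ℝ φ →
      (∀ j w, (fderiv ℝ φ w).comp (blockIncl H j) =
        ∑ m, (blockIncl H m).comp (blockDeriv (blockIncl H) j (y m) w)) →
      (∀ l, k = l + 1 → ∀ m j, OmegaClass (blockIncl H) l {m, j} (1 + C')
        (blockDeriv (blockIncl H) j (y m))) →
      OmegaClass (blockIncl H) k S C₁ f → OmegaClass (blockIncl H) k S C₂ fun w => f (φ w) := by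
    cases k with
    | zero => exact ⟨C₁, hC₁, fun S f φ y _ _ _ _ hf w => hf (φ w)⟩
    | succ k =>
      obtain ⟨C₂, hC₂, h⟩ := exists_omegaClass_comp (Q := H × H) (k + 1) (2 + (k + 1)) C₁
        (1 + C') hC₁ (by positivity)
      exact ⟨C₂, hC₁.trans hC₂, fun S f φ y hS hφ hE hy hf =>
        h S f φ y (by omega) hφ hE (hy k rfl) hf⟩
  obtain ⟨C₃, hC₃, hsol⟩ := exists_omegaClass_solution (Q := H × H) k (k + 1) C₂ (1 + C₂) K
    hC₂ (by positivity) hK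
  refine ⟨C₃, hC₃, ?_⟩
  intro N _ J G a hJ hGd hG hsv ha heq hlow j
  have had : Differentiable ℝ a := ha.differentiable (by simp)
  have hai : ∀ m, ContDiff ℝ (k + 1 : ℕ) fun w => a w m := fun m => contDiff_pi.1 ha m
  set E : Fin N → H × H →L[ℝ] (Fin N → H) × (Fin N → H) := blockIncl H with hE
  set φ : (Fin N → H) × (Fin N → H) → (Fin N → H) × (Fin N → H) := fun w => (w.1, a w) with hφ
  have hφd : Differentiable ℝ φ := differentiable_fst.prodMk had
  set y : Fin N → (Fin N → H) × (Fin N → H) → H × H := fun m w => (w.1 m, a w m) with hy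
  have hyE : ∀ m j w, blockDeriv E j (y m) w =
      (ContinuousLinearMap.inl ℝ H H).comp
        (if m = j then ContinuousLinearMap.fst ℝ H H else 0) +
      (ContinuousLinearMap.inr ℝ H H).comp (blockDeriv E j (fun w => a w m) w) :=
    blockDeriv_block_graph had
  have hφE : ∀ j w, (fderiv ℝ φ w).comp (E j) =
      ∑ m, (E m).comp (blockDeriv E j (y m) w) := fderiv_graph_comp_blockIncl had
  have hylow : ∀ l, k = l + 1 → ∀ m j, OmegaClass E l {m, j} (1 + C') (blockDeriv E j (y m)) :=
    fun l hl m j => (hlow l hl j m).blockDeriv_block_graph had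
  have hcard : ∀ i m : Fin N, ({i, m} : Finset (Fin N)).card ≤ 2 := fun i m =>
    Finset.card_le_two
  have hGφ : ∀ i m, OmegaClass E k {i, m} C₂ fun w => blockDeriv E m (G i) (φ w) := fun i m =>
    hcomp {i, m} _ φ y (hcard i m) hφd hφE hylow (hG i m)
  -- the coefficients `D_{a^m} G_i` and the right-hand side of the linear system
  set A : Fin N → Fin N → (Fin N → H) × (Fin N → H) → H →L[ℝ] Z := fun i m w =>
    (blockDeriv E m (G i) (φ w)).comp (ContinuousLinearMap.inr ℝ H H) with hA
  set b : Fin N → (Fin N → H) × (Fin N → H) → H × H →L[ℝ] Z := fun i w =>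
    (if i = j then -J.comp (ContinuousLinearMap.snd ℝ H H) else 0) +
      -(blockDeriv E j (G i) (φ w)).comp
        ((ContinuousLinearMap.inl ℝ H H).comp (ContinuousLinearMap.fst ℝ H H)) with hb
  have hAclass : ∀ i m, OmegaClass E k {i, m} C₂ (A i m) := by
    intro i m
    have h1 := (hGφ i m).clm_comp_right (ContinuousLinearMap.inr ℝ H H)
      (ContinuousLinearMap.norm_inr_le_one ℝ H H)
    rwa [one_mul] at h1
  have hJb : ‖-(J.comp (ContinuousLinearMap.snd ℝ H H))‖ ≤ 1 := by
    refine ContinuousLinearMap.opNorm_le_bound _ zero_le_one fun q => ?_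
    rw [neg_apply, norm_neg]
    exact J.le_of_opNorm_le_of_le hJ (norm_snd_le q)
  have hbclass : ∀ i, OmegaClass E k (insert i {j}) (1 + C₂) (b i) := by
    intro i
    refine OmegaClass.add (omegaClass_const k _ zero_le_one ?_) (OmegaClass.neg ?_)
    · split_ifs with h
      · subst h
        rw [Finset.pair_eq_singleton, omegaN_singleton, mul_one]
        exact hJb
      · rw [one_mul]
        exact (norm_zero (E := H × H →L[ℝ] Z)).trans_le (omegaN_nonneg _)
    · have h1 := (hGφ i j).clm_comp_right
        ((ContinuousLinearMap.inl ℝ H H).comp (ContinuousLinearMap.fst ℝ H H))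
        ((ContinuousLinearMap.opNorm_comp_le _ _).trans
          (mul_le_one₀ (ContinuousLinearMap.norm_inl_le_one ℝ H H) (norm_nonneg _)
            (ContinuousLinearMap.norm_fst_le ℝ H H)))
      rwa [one_mul] at h1
  have hsolvA : ∀ w, OmegaSolvable (k + 1) K (fun i m => A i m w)
      (ContinuousLinearMap.compL ℝ (H × H) H Z) := fun w => (hsv (φ w)).compL hK (H × H)
  have hlin : ∀ i w, ∑ m, ContinuousLinearMap.compL ℝ (H × H) H Z (A i m w)
      (blockDeriv E j (fun w => a w m) w) = b i w := by
    intro i w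
    have h1 : (∑ m, (blockDeriv E m (G i) (φ w)).comp (blockDeriv E j (y m) w)) =
        if i = j then -J.comp (ContinuousLinearMap.snd ℝ H H) else 0 := by
      have h2 : blockDeriv E j (fun w => G i (φ w)) w =
          ∑ m, (blockDeriv E m (G i) (φ w)).comp (blockDeriv E j (y m) w) := by
        simp only [blockDeriv]
        rw [fderiv_fun_comp w (hGd i _) (hφd w), ContinuousLinearMap.comp_assoc, hφE]
        refine ContinuousLinearMap.ext fun q => ?_
        simp only [ContinuousLinearMap.comp_apply, sum_apply, map_sum, blockDeriv]
      rw [← h2]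
      have h3 : (fun w => G i (φ w)) = fun w => -J (w.2 i) := funext fun w => heq w i
      have h4 : HasFDerivAt (fun w : (Fin N → H) × (Fin N → H) => -J (w.2 i))
          (-J.comp ((ContinuousLinearMap.proj i).comp
            (ContinuousLinearMap.snd ℝ (Fin N → H) (Fin N → H)))) w :=
        (J.comp ((ContinuousLinearMap.proj i).comp
          (ContinuousLinearMap.snd ℝ (Fin N → H) (Fin N → H)))).hasFDerivAt.neg
      rw [h3, blockDeriv, h4.fderiv]
      by_cases h : i = j
      · subst h
        refine ContinuousLinearMap.ext fun q => ?_
        simp [hE, blockIncl_apply]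
      · refine ContinuousLinearMap.ext fun q => ?_
        simp [hE, blockIncl_apply, h]
    have h5 : (∑ m, (blockDeriv E m (G i) (φ w)).comp (blockDeriv E j (y m) w)) =
        (blockDeriv E j (G i) (φ w)).comp
          ((ContinuousLinearMap.inl ℝ H H).comp (ContinuousLinearMap.fst ℝ H H)) +
        ∑ m, (A i m w).comp (blockDeriv E j (fun w => a w m) w) := by
      simp only [hyE, ContinuousLinearMap.comp_add, Finset.sum_add_distrib]
      congr 1
      rw [Finset.sum_eq_single j]
      · rw [if_pos rfl]
      · intro m _ hm
        rw [if_neg hm, ContinuousLinearMap.comp_zero, ContinuousLinearMap.comp_zero]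
      · simp
    change ∑ m, (A i m w).comp (blockDeriv E j (fun w => a w m) w) = b i w
    rw [hb]
    dsimp only
    rw [← h1, h5]
    abel
  intro m
  refine hsol (ContinuousLinearMap.compL ℝ (H × H) H Z) {j} A
    (fun m => blockDeriv E j fun w => a w m) b ?_ (by simp; omega) (fun m => ?_) hsolvA hAclass
    hbclass hlin m
  · exact ContinuousLinearMap.norm_compL_le ℝ (H × H) H Z
  · have : ContDiff ℝ k (fderiv ℝ fun w => a w m) :=
      (hai m).fderiv_right (by push_cast; exact le_rfl)
    exact this.clm_comp contDiff_const

/-- The block derivatives of any order of the solution map, by induction on the order. -/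
theorem exists_omegaClass_solutionMap (k : ℕ) (H Z : Type) [NormedAddCommGroup H]
    [NormedSpace ℝ H] [NormedAddCommGroup Z] [NormedSpace ℝ Z] (K C₁ : ℝ) (hK : 0 ≤ K)
    (hC₁ : 0 ≤ C₁) :
    ∃ C : ℝ, 0 ≤ C ∧ ∀ {N : ℕ} [NeZero N]
      (J : H →L[ℝ] Z) (G : Fin N → (Fin N → H) × (Fin N → H) → Z)
      (a : (Fin N → H) × (Fin N → H) → (Fin N → H)),
      ‖J‖ ≤ 1 → (∀ i, Differentiable ℝ (G i)) →
      (∀ i m, OmegaClass (blockIncl H) k {i, m} C₁ (blockDeriv (blockIncl H) m (G i))) →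
      (∀ w, OmegaSolvable (k + 1) K (fun i m => (blockDeriv (blockIncl H) m (G i) w).comp
        (ContinuousLinearMap.inr ℝ H H)) (ContinuousLinearMap.id ℝ (H →L[ℝ] Z))) →
      ContDiff ℝ (k + 1 : ℕ) a → (∀ w i, G i (w.1, a w) = -J (w.2 i)) →
      ∀ j m, OmegaClass (blockIncl H) k {m, j} C (blockDeriv (blockIncl H) j fun w => a w m) := by
  induction k with
  | zero =>
    obtain ⟨C, hC, h⟩ := exists_omegaClass_solutionMap_step 0 H Z K C₁ 0 hK hC₁ le_rfl
    exact ⟨C, hC, fun J G a hJ hGd hG hsv ha heq =>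
      h J G a hJ hGd hG hsv ha heq fun l hl => absurd hl (by omega)⟩
  | succ k ih =>
    obtain ⟨C', hC', h'⟩ := ih
    obtain ⟨C, hC, h⟩ := exists_omegaClass_solutionMap_step (k + 1) H Z K C₁ C' hK hC₁ hC'
    refine ⟨C, hC, fun J G a hJ hGd hG hsv ha heq => h J G a hJ hGd hG hsv ha heq fun l hl => ?_⟩
    obtain rfl : k = l := by omega
    exact h' J G a hJ hGd (fun i m => (hG i m).of_succ)
      (fun w S v β hS => hsv w S v β (by omega))
      (ha.of_le (by exact_mod_cast Nat.le_succ (k + 1))) heq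

end SolutionMap

/-! ### The partial derivatives `D_{x^j}` and `D_{p^j}` -/

section PartialDerivatives

variable {d N : ℕ} {V : Type} [NormedAddCommGroup V] [NormedSpace ℝ V]
  {f : (Fin N → Rd d) × (Fin N → Rd d) → V}

theorem hasFDerivAt_update_single (x : Fin N → Rd d) (j : Fin N) (y : Rd d) :
    HasFDerivAt (Function.update x j) (ContinuousLinearMap.single ℝ (fun _ => Rd d) j) y := by
  refine (hasFDerivAt_update (𝕜 := ℝ) x y).congr_fderiv (ContinuousLinearMap.ext fun v => ?_)
  refine funext fun m => ?_
  rcases eq_or_ne m j with rfl | hm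
  · simp
  · simp [hm]

theorem Dx_eq_blockDeriv (hf : Differentiable ℝ f) (j : Fin N) :
    Dx j f = fun w => (blockDeriv (blockIncl (Rd d)) j f w).comp
      (ContinuousLinearMap.inl ℝ (Rd d) (Rd d)) := by
  funext w
  have h1 : HasFDerivAt (fun y => (Function.update w.1 j y, w.2))
      ((ContinuousLinearMap.single ℝ (fun _ => Rd d) j).prod 0) (w.1 j) := by
    refine HasFDerivAt.prodMk ?_ (hasFDerivAt_const _ _)
    exact hasFDerivAt_update_single w.1 j (w.1 j)
  have h2 : HasFDerivAt f (fderiv ℝ f w) (Function.update w.1 j (w.1 j), w.2) := by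
    rw [Function.update_eq_self]
    exact (hf w).hasFDerivAt
  have h3 : HasFDerivAt (fun y => f (Function.update w.1 j y, w.2)) _ (w.1 j) := h2.comp (w.1 j) h1
  rw [Dx, h3.fderiv]
  refine ContinuousLinearMap.ext fun v => ?_
  simp [blockDeriv, blockIncl_apply]

theorem Dp_eq_blockDeriv (hf : Differentiable ℝ f) (j : Fin N) :
    Dp j f = fun w => (blockDeriv (blockIncl (Rd d)) j f w).comp
      (ContinuousLinearMap.inr ℝ (Rd d) (Rd d)) := by
  funext w
  have h1 : HasFDerivAt (fun y => (w.1, Function.update w.2 j y))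
      (ContinuousLinearMap.prod 0 (ContinuousLinearMap.single ℝ (fun _ => Rd d) j)) (w.2 j) := by
    refine HasFDerivAt.prodMk (hasFDerivAt_const _ _) ?_
    exact hasFDerivAt_update_single w.2 j (w.2 j)
  have h2 : HasFDerivAt f (fderiv ℝ f w) (w.1, Function.update w.2 j (w.2 j)) := by
    rw [Function.update_eq_self]
    exact (hf w).hasFDerivAt
  have h3 : HasFDerivAt (fun y => f (w.1, Function.update w.2 j y)) _ (w.2 j) := h2.comp (w.2 j) h1
  rw [Dp, h3.fderiv]
  refine ContinuousLinearMap.ext fun v => ?_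
  simp [blockDeriv, blockIncl_apply]

theorem omegaClass_Dx {k : ℕ} {S : Finset (Fin N)} {C : ℝ} (hf : Differentiable ℝ f) {j : Fin N}
    (h : OmegaClass (blockIncl (Rd d)) k S C (blockDeriv (blockIncl (Rd d)) j f)) :
    OmegaClass (blockIncl (Rd d)) k S C (Dx j f) := by
  rw [Dx_eq_blockDeriv hf]
  simpa using h.clm_comp_right _ (ContinuousLinearMap.norm_inl_le_one ℝ (Rd d) (Rd d))

theorem omegaClass_Dp {k : ℕ} {S : Finset (Fin N)} {C : ℝ} (hf : Differentiable ℝ f) {j : Fin N}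
    (h : OmegaClass (blockIncl (Rd d)) k S C (blockDeriv (blockIncl (Rd d)) j f)) :
    OmegaClass (blockIncl (Rd d)) k S C (Dp j f) := by
  rw [Dp_eq_blockDeriv hf]
  simpa using h.clm_comp_right _ (ContinuousLinearMap.norm_inr_le_one ℝ (Rd d) (Rd d))

theorem OmegaClass.Dx {k : ℕ} {S : Finset (Fin N)} {C : ℝ}
    (h : OmegaClass (blockIncl (Rd d)) (k + 1) S C f) (j : Fin N) :
    OmegaClass (blockIncl (Rd d)) k (insert j S) C (Dx j f) :=
  omegaClass_Dx h.2.1 (h.2.2 j)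

theorem OmegaClass.Dp {k : ℕ} {S : Finset (Fin N)} {C : ℝ}
    (h : OmegaClass (blockIncl (Rd d)) (k + 1) S C f) (j : Fin N) :
    OmegaClass (blockIncl (Rd d)) k (insert j S) C (Dp j f) :=
  omegaClass_Dp h.2.1 (h.2.2 j)

theorem OmegaClass.supNorm_le {k : ℕ} {S S' : Finset (Fin N)} {C : ℝ}
    (h : OmegaClass (blockIncl (Rd d)) k S C f) (hS : S = S') :
    supNorm f ≤ ENNReal.ofReal (C * omegaN S') := by
  subst hS
  refine iSup_le fun w => ?_
  rw [← ofReal_norm]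
  exact ENNReal.ofReal_le_ofReal (h.bound w)

end PartialDerivatives

/-! ### The fixed-point map of the game -/

section Fixedpoint

variable {d : ℕ}

/-- `D_a L(x^i, a^i, m^{-i})`, regarded as a linear form, as a function of all the states and
controls. Here `Dz` is the derivative of `L` in the vector variables. -/
def controlDeriv (Dz : Rd d × Rd d → P2xa d → Rd d × Rd d →L[ℝ] ℝ) {N : ℕ} (hN : 2 ≤ N) (i : Fin N)
    (w : (Fin N → Rd d) × (Fin N → Rd d)) : Rd d →L[ℝ] ℝ :=
  (Dz (blocks (Rd d) N w i) (othersMeasure hN i (blocks (Rd d) N w))).comp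
    (ContinuousLinearMap.inr ℝ (Rd d) (Rd d))

theorem controlDeriv_eq_toDual {L : Rd d → Rd d → P2xa d → ℝ}
    {Dz : Rd d × Rd d → P2xa d → Rd d × Rd d →L[ℝ] ℝ}
    (hz : ∀ z μ, HasFDerivAt (fun z' : Rd d × Rd d => L z'.1 z'.2 μ) (Dz z μ) z) {N : ℕ}
    (hN : 2 ≤ N) (i : Fin N) (x a : Fin N → Rd d) :
    controlDeriv Dz hN i (x, a) = InnerProductSpace.toDual ℝ (Rd d)
      (gradA L (x i) (a i) (othersMeasure hN i fun j => (x j, a j))) :=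
  (hasFDerivAt_and_toDual_gradA hz _ _ _).2.symm

theorem contDiff_controlDeriv {Dz : Rd d × Rd d → P2xa d → Rd d × Rd d →L[ℝ] ℝ} {k l : ℕ}
    (h : IsCkBounded k l Dz) {N : ℕ} (hN : 2 ≤ N) (i : Fin N) :
    ContDiff ℝ k (controlDeriv Dz hN i) :=
  (h.contDiff_weightedP2 (sum_othersWeight hN i)
    ((ContinuousLinearMap.proj i).comp (blocks (Rd d) N)) (blocks (Rd d) N)).clm_comp contDiff_const

theorem exists_omegaClass_blockDeriv_controlDeriv
    {Dz : Rd d × Rd d → P2xa d → Rd d × Rd d →L[ℝ] ℝ} {k : ℕ} (h : IsCkBounded (k + 1) 1 Dz) :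
    ∃ C : ℝ, 0 ≤ C ∧ ∀ {N : ℕ} (hN : 2 ≤ N) (i j : Fin N), OmegaClass (blockIncl (Rd d)) k {i, j} C
      (blockDeriv (blockIncl (Rd d)) j (controlDeriv Dz hN i)) := by
  obtain ⟨C, hC, H⟩ := h.exists_omegaClass_blockDeriv
  refine ⟨C, hC, fun {N} hN i j => ?_⟩
  have h1 := H hN (blockIncl (Rd d)) (blocks (Rd d) N) blocks_blockIncl i j
  set ℓ : (Rd d × Rd d →L[ℝ] ℝ) →L[ℝ] (Rd d →L[ℝ] ℝ) :=
    (ContinuousLinearMap.compL ℝ (Rd d) (Rd d × Rd d) ℝ).flip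
      (ContinuousLinearMap.inr ℝ (Rd d) (Rd d)) with hℓ
  have hℓ1 : ‖ℓ‖ ≤ 1 := by
    refine ContinuousLinearMap.opNorm_le_bound _ zero_le_one fun T => ?_
    rw [mul_comm]
    exact (T.opNorm_comp_le _).trans (mul_le_mul_of_nonneg_left
      (ContinuousLinearMap.norm_inr_le_one ℝ (Rd d) (Rd d)) (norm_nonneg T))
  have hd : Differentiable ℝ fun w : (Fin N → Rd d) × (Fin N → Rd d) =>
      Dz (blocks (Rd d) N w i) (othersMeasure hN i (blocks (Rd d) N w)) :=
    (h.contDiff_weightedP2 (sum_othersWeight hN i)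
      ((ContinuousLinearMap.proj i).comp (blocks (Rd d) N)) (blocks (Rd d) N)).differentiable
        (by simp)
  have heq := blockDeriv_clm_comp (E := blockIncl (Rd d)) hd ℓ j
  have h2 := h1.clm_comp_left ℓ hℓ1
  rw [one_mul] at h2
  change OmegaClass _ _ _ _ (blockDeriv (blockIncl (Rd d)) j fun w =>
    ℓ (Dz (blocks (Rd d) N w i) (othersMeasure hN i (blocks (Rd d) N w))))
  rw [heq]
  exact h2

/-- Coercivity and the decay of the block derivatives give the weighted solvability of the
linearized system. -/
theorem exists_omegaSolvable_blockDeriv (n : ℕ) (c C₁ : ℝ) (hc : 0 < c) (hC₁ : 0 ≤ C₁) :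
    ∃ K : ℝ, 0 ≤ K ∧ ∀ {N : ℕ} [NeZero N] {H : Type} [NormedAddCommGroup H] [NormedSpace ℝ H]
      (G : Fin N → (Fin N → H) × (Fin N → H) → H →L[ℝ] ℝ) (w : (Fin N → H) × (Fin N → H)),
      (∀ i m, ‖blockDeriv (blockIncl H) m (G i) w‖ ≤ C₁ * omegaN {i, m}) →
      (∀ ξ : Fin N → H, c * ∑ i, ‖ξ i‖ ^ 2 ≤ ∑ i, fderiv ℝ (G i) w (0, ξ) (ξ i)) →
      OmegaSolvable n K (fun i m => (blockDeriv (blockIncl H) m (G i) w).comp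
        (ContinuousLinearMap.inr ℝ H H)) (ContinuousLinearMap.id ℝ (H →L[ℝ] H →L[ℝ] ℝ)) := by
  obtain ⟨K, hK, h⟩ := exists_omegaSolvable_of_coercive n c C₁ hc hC₁
  refine ⟨K, hK, fun {N} _ H _ _ G w hG hco => h _ (fun i m => ?_) fun ξ => ?_⟩
  · refine ((blockDeriv (blockIncl H) m (G i) w).opNorm_comp_le _).trans ?_
    refine (mul_le_of_le_one_right (norm_nonneg _)
      (ContinuousLinearMap.norm_inr_le_one ℝ H H)).trans (hG i m)
  · refine (hco ξ).trans (le_of_eq (Finset.sum_congr rfl fun i _ => ?_))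
    have h1 : ((0 : Fin N → H), ξ) = ∑ m, blockIncl H m (0, ξ m) :=
      (sum_blockIncl_blocks (0, ξ)).symm
    rw [h1, map_sum, sum_apply]
    rfl

/-- The fixed-point map is the solution map of the system
`D_a L(x^i, a^i, m^{-i}) = -p^i`, which is strongly monotone for large `N`. -/
theorem exists_fixedPointMap (L : Rd d → Rd d → P2xa d → ℝ)
    (hreg : RegularityAssumption L) (hmon : MonotonicityAssumption L) :
    ∃ (C : ℝ) (N₀ : ℕ), 0 ≤ C ∧ ∀ (N : ℕ) (hN : 2 ≤ N), N₀ ≤ N →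
      ∃ a : (Fin N → Rd d) × (Fin N → Rd d) → (Fin N → Rd d),
        (∀ x p b : Fin N → Rd d, IsFixedPoint L hN x p b ↔ b = a (x, p)) ∧ ContDiff ℝ 4 a ∧
        ∀ j i, OmegaClass (blockIncl (Rd d)) 2 {i, j} C
          (blockDeriv (blockIncl (Rd d)) j fun w => a w i) := by
  obtain ⟨-, -, Dz, -, hz, -, hDz, -⟩ := hreg.smooth_L
  have hDz : IsCkBounded 4 1 Dz := hDz
  obtain ⟨c, N₀, hc, hmon'⟩ := exists_sum_inner_othersMeasure hmon hreg.lipschitz_DaL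
  obtain ⟨C₁, hC₁, hG⟩ := exists_omegaClass_blockDeriv_controlDeriv hDz
  obtain ⟨K, hK, hsolv⟩ := exists_omegaSolvable_blockDeriv 3 c C₁ hc hC₁
  obtain ⟨C, hC, hbound⟩ := exists_omegaClass_solutionMap 2 (Rd d) (Rd d →L[ℝ] ℝ) K C₁ hK hC₁
  refine ⟨C, N₀, hC, fun N hN hN₀ => ?_⟩
  have hN0 : NeZero N := ⟨by omega⟩
  have hGc : ∀ i, ContDiff ℝ (4 : ℕ) (controlDeriv Dz hN i) := contDiff_controlDeriv hDz hN
  have hGd : ∀ i, Differentiable ℝ (controlDeriv Dz hN i) := fun i =>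
    (hGc i).differentiable (by simp)
  have hGmon : ∀ x a b : Fin N → Rd d, c * ∑ i, ‖a i - b i‖ ^ 2 ≤
      ∑ i, (controlDeriv Dz hN i (x, a) - controlDeriv Dz hN i (x, b)) (a i - b i) := by
    intro x a b
    refine (hmon' hN hN₀ x a b).trans (le_of_eq (Finset.sum_congr rfl fun i _ => ?_))
    rw [controlDeriv_eq_toDual hz, controlDeriv_eq_toDual hz, ← map_sub,
      InnerProductSpace.toDual_apply_apply]
  obtain ⟨a, ha, hsol⟩ := exists_contDiff_solution (n := (4 : ℕ)) (by norm_num) hGc hc hGmon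
  refine ⟨a, fun x p b => ?_, by exact_mod_cast ha, ?_⟩
  · rw [← hsol]
    refine forall_congr' fun i => ?_
    rw [hreg.eq_neg_gradA_hamiltonian_iff, empiricalOthers_eq, controlDeriv_eq_toDual hz,
      ← (InnerProductSpace.toDual ℝ (Rd d)).injective.eq_iff, map_neg]
    rfl
  · refine hbound (innerSL ℝ) (controlDeriv Dz hN) a ?_ hGd
      (fun i m => (hG hN i m).of_succ) (fun w => ?_) (ha.of_le (by norm_num)) (fun w i => ?_)
    · exact norm_innerSL_le ℝ
    · exact hsolv (controlDeriv Dz hN) w (fun i m => (hG hN i m).bound w)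
        (le_sum_fderiv_of_monotone hGd hGmon w)
    · exact (hsol w.1 w.2 (a w)).2 rfl i

end Fixedpoint

end

theorem proposition3p2 {d : ℕ} (L : Rd d → Rd d → P2xa d → ℝ)
    (hreg : RegularityAssumption L) (hmon : MonotonicityAssumption L) :
    ∃ (C : ℝ) (N₀ : ℕ), ∀ (N : ℕ) (hN : 2 ≤ N), N₀ ≤ N →
      ∃ a : (Fin N → Rd d) × (Fin N → Rd d) → (Fin N → Rd d),
        -- `a` is the map which is uniquely defined by the fixed-point equation
        (∀ x p b : Fin N → Rd d, IsFixedPoint L hN x p b ↔ b = a (x, p)) ∧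
        ContDiff ℝ 4 a ∧
        (∀ i j : Fin N,
          supNorm (Dx j (fun xp => a xp i)) + supNorm (Dp j (fun xp => a xp i))
            ≤ ENNReal.ofReal (C * omegaN {i, j})) ∧
        (∀ i j k : Fin N,
          supNorm (Dx k (Dx j (fun xp => a xp i))) + supNorm (Dx k (Dp j (fun xp => a xp i)))
              + supNorm (Dp k (Dp j (fun xp => a xp i)))
            ≤ ENNReal.ofReal (C * omegaN {i, j, k})) ∧
        (∀ i j k l : Fin N,
          supNorm (Dx l (Dx k (Dx j (fun xp => a xp i))))
              + supNorm (Dx l (Dx k (Dp j (fun xp => a xp i))))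
              + supNorm (Dx l (Dp k (Dp j (fun xp => a xp i))))
              + supNorm (Dp l (Dp k (Dp j (fun xp => a xp i))))
            ≤ ENNReal.ofReal (C * omegaN {i, j, k, l})) := by
  obtain ⟨C, N₀, hC, H⟩ := exists_fixedPointMap L hreg hmon
  refine ⟨4 * C, N₀, fun N hN hN₀ => ?_⟩
  obtain ⟨a, hfix, ha, hcl⟩ := H N hN hN₀
  have had : ∀ i, Differentiable ℝ fun xp => a xp i := fun i =>
    (contDiff_pi.1 ha i).differentiable (by norm_num)
  have hx : ∀ i j, OmegaClass (blockIncl (Rd d)) 2 {i, j} C (Dx j fun xp => a xp i) := fun i j =>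
    omegaClass_Dx (had i) (hcl j i)
  have hp : ∀ i j, OmegaClass (blockIncl (Rd d)) 2 {i, j} C (Dp j fun xp => a xp i) := fun i j =>
    omegaClass_Dp (had i) (hcl j i)
  have hsum : ∀ (n : ℕ) (S : Finset (Fin N)), n ≤ 4 →
      (n : ℝ≥0∞) * ENNReal.ofReal (C * omegaN S) ≤ ENNReal.ofReal (4 * C * omegaN S) := by
    intro n S hn
    rw [mul_assoc, ENNReal.ofReal_mul (p := 4) (by norm_num)]
    gcongr
    simpa using (by exact_mod_cast hn : (n : ℝ≥0∞) ≤ 4)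
  refine ⟨a, hfix, ha, fun i j => ?_, fun i j k => ?_, fun i j k l => ?_⟩
  · refine le_trans ?_ (hsum 2 {i, j} (by norm_num))
    have h1 := (hx i j).supNorm_le rfl
    have h2 := (hp i j).supNorm_le rfl
    refine (add_le_add h1 h2).trans (le_of_eq ?_)
    push_cast
    ring
  · have hS : (insert k {i, j} : Finset (Fin N)) = {i, j, k} := by
      ext; simp; tauto
    refine le_trans ?_ (hsum 3 {i, j, k} (by norm_num))
    have h1 := ((hx i j).Dx k).supNorm_le hS
    have h2 := ((hp i j).Dx k).supNorm_le hS
    have h3 := ((hp i j).Dp k).supNorm_le hS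
    refine (add_le_add (add_le_add h1 h2) h3).trans (le_of_eq ?_)
    push_cast
    ring
  · have hS : (insert l (insert k {i, j}) : Finset (Fin N)) = {i, j, k, l} := by
      ext; simp; tauto
    refine le_trans ?_ (hsum 4 {i, j, k, l} le_rfl)
    have h1 := (((hx i j).Dx k).Dx l).supNorm_le hS
    have h2 := (((hp i j).Dx k).Dx l).supNorm_le hS
    have h3 := (((hp i j).Dp k).Dx l).supNorm_le hS
    have h4 := (((hp i j).Dp k).Dp l).supNorm_le hS
    refine (add_le_add (add_le_add (add_le_add h1 h2) h3) h4).trans (le_of_eq ?_)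
    push_cast
    ring
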